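/- For $n\in\mathbb N$ let $[n]=\{0,\dots,n\}$. Put $q_i=\frac{i(i+1)}2$ and, for $x\in\mathbb N$, let $c(x)=\max\{i : q_i\le x\}$ and $r(x)=x-q_{c(x)}$. Let $\sqsubset$ be the linear order on $\mathbb N$ with $$x\sqsubset y \iff r(x)<r(y)\ \text{ or }\ \bigl(r(x)=r(y)\text{ and }c(x)<c(y)\bigr),$$ and let $\mathrm{Bit}=\{(a,i)\in\mathbb N^2 : 2\nmid\lfloor a/2^i\rfloor\}$. For a list $\ell$ of predicates on $\mathbb N$ and a vocabulary $\tau$, an $\mathrm{FO}(\ell)$-sentence over $\tau$ is a first-order sentence (with equality) in the symbols of $\tau$ and $\ell$. It is evaluated in $\tau$-structures with universe $[n]$, $n\in\mathbb N$, where every predicate in $\ell$ is interpreted by its restriction to $[n]$. $\mathrm{FO}(\ell)$ is *at most as expressive as* $\mathrm{FO}(\ell')$ if, for every $\tau$, every $\mathrm{FO}(\ell)$-sentence over $\tau$ is equivalent, on all $\tau$-structures with universe $[n]$ and for all $n$, to one $\mathrm{FO}(\ell')$-sentence over $\tau$; it is *strictly less expressive* if the converse fails in addition. A non-empty string $w_0\cdots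 w_n$ over a finite alphabet $A$ is identified with the structure on $[n]$ with the unary predicates $Q_a=\{i : w_i=a\}$, $a\in A$. A language $L\subseteq A^*$ is *definable* in $\mathrm{FO}(\ell)$ if some $\mathrm{FO}(\ell)$-sentence holds in exactly those non-empty strings over $A$ that belong to $L$. A letter $e\in A$ is *neutral* for $L$ if $w_1w_2\in L\iff w_1ew_2\in L$ for all $w_1,w_2\in A^*$. **Theorem.** $\mathrm{FO}(<,\sqsubset)$ is strictly less expressive than $\mathrm{FO}(\mathrm{Bit})$. The two logics already differ on strings: some language over a finite alphabet is definable in $\mathrm{FO}(\mathrm{Bit})$ but not in $\mathrm{FO}(<,\sqsubset)$. Moreover, $\mathrm{FO}(<,\sqsubset)$ has the Crane Beach property: every language over a finite alphabet that is definable in $\mathrm{FO}(<,\sqsubset)$ and has a neutral letter is definable in $\mathrm{FO}(<)$. -/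

import Mathlib

namespace CraneBeach

/-! ### Built-in predicates

Throughout, the universe `[n] = {0, …, n}` is `Fin (n + 1)`. -/

/-- A family of built-in predicates: for every arity `k` a type of names of `k`-ary predicates, and
for every such name a sequence `(Rⁿ)` of relations with `Rⁿ ⊆ [n]ᵏ`. -/
structure BuiltIns where
  /-- the names of the `k`-ary predicates -/
  Sym : ℕ → Type
  /-- the relation `Rⁿ` on `[n]` denoted by a name -/
  interp : ∀ (n : ℕ) {k : ℕ}, Sym k → (Fin k → Fin (n + 1)) → Prop

/-- Numerical predicates `P ⊆ ℕᵏ` induce built-in predicates by `Pⁿ = P ∩ [n]ᵏ`. -/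
def BuiltIns.ofNumerical (Sym : ℕ → Type) (P : ∀ {k : ℕ}, Sym k → (Fin k → ℕ) → Prop) :
    BuiltIns where
  Sym := Sym
  interp _ _ R v := P R fun i => (v i : ℕ)

/-- The relational vocabulary consisting of the names of the built-in predicates. -/
def BuiltIns.lang (B : BuiltIns) : FirstOrder.Language.{0, 0} where
  Functions _ := Empty
  Relations := B.Sym

/-- The structure on `[n]` given by the built-in predicates. -/
@[reducible] def BuiltIns.str (B : BuiltIns) (n : ℕ) : B.lang.Structure (Fin (n + 1)) where
  funMap f _ := f.elim
  RelMap R v := B.interp n R v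

/-- Sentences of the logic `FO(B)` over the vocabulary `τ`: first-order sentences (with equality)
that may use the symbols of `τ` and the built-in predicates. -/
abbrev BuiltIns.Sentence (B : BuiltIns) (τ : FirstOrder.Language.{0, 0}) : Type :=
  (τ.sum B.lang).Sentence

/-- A `τ`-structure `S` with universe `[n]` satisfies the `FO(B)`-sentence `φ`, the built-in
predicates being interpreted by their `n`-th relations. -/
def BuiltIns.Models (B : BuiltIns) {τ : FirstOrder.Language.{0, 0}} {n : ℕ}
    (S : τ.Structure (Fin (n + 1))) (φ : B.Sentence τ) : Prop :=
  letI := S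
  letI := B.str n
  φ.Realize (Fin (n + 1))

/-! ### Expressive power on finite structures -/

/-- `FO(B)` is at most as expressive as `FO(B')` on the class of all finite structures: over every
vocabulary, every `FO(B)`-sentence is equivalent to some `FO(B')`-sentence. -/
def AtMostAsExpressive (B B' : BuiltIns) : Prop :=
  ∀ (τ : FirstOrder.Language.{0, 0}) (φ : B.Sentence τ), ∃ ψ : B'.Sentence τ,
    ∀ (n : ℕ) (S : τ.Structure (Fin (n + 1))), B.Models S φ ↔ B'.Models S ψ

/-- `FO(B)` is strictly less expressive than `FO(B')`. -/
def StrictlyLessExpressive (B B' : BuiltIns) : Prop :=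
  AtMostAsExpressive B B' ∧ ¬ AtMostAsExpressive B' B

/-! ### String-languages and the Crane Beach property -/

/-- The vocabulary of strings over `A`: a unary predicate `Q_a` for every letter `a`. -/
inductive LetterSym (A : Type) : ℕ → Type
  | letter (a : A) : LetterSym A 1

/-- The relational vocabulary of strings over the alphabet `A`. -/
def wordLang (A : Type) : FirstOrder.Language.{0, 0} where
  Functions _ := Empty
  Relations := LetterSym A

/-- The structure on `[n]` of the string `w₀ w₁ ⋯ wₙ`, where `Q_a = {i | wᵢ = a}`. -/
@[reducible] def wordStr {A : Type} {n : ℕ} (w : Fin (n + 1) → A) :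
    (wordLang A).Structure (Fin (n + 1)) where
  funMap f _ := f.elim
  RelMap R := match R with
    | .letter a => fun v => w (v 0) = a

/-- The string-language `L ⊆ A*` is definable in `FO(B)`. As universes are non-empty, this is
a condition on the non-empty strings only. -/
def Definable (B : BuiltIns) {A : Type} (L : Set (List A)) : Prop :=
  ∃ φ : B.Sentence (wordLang A), ∀ (n : ℕ) (w : Fin (n + 1) → A),
    List.ofFn w ∈ L ↔ B.Models (wordStr w) φ

/-- The letter `e` is neutral for `L`. -/
def Neutral {A : Type} (e : A) (L : Set (List A)) : Prop :=
  ∀ w₁ w₂ : List A, w₁ ++ w₂ ∈ L ↔ w₁ ++ [e] ++ w₂ ∈ L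

/-! ### The particular predicates -/

/-- `q i = i (i + 1) / 2`, the smallest number in column `i`. -/
def q (i : ℕ) : ℕ := i * (i + 1) / 2

theorem le_q (i : ℕ) : i ≤ q i := by
  unfold q
  rw [Nat.le_div_iff_mul_le (by norm_num)]
  rcases i with _ | i
  · simp
  · exact Nat.mul_le_mul_left _ (by omega)

/-- The column number of `x`, i.e. the largest `i` with `q i ≤ x`. -/
def col (x : ℕ) : ℕ := Nat.findGreatest (fun i => q i ≤ x) x

theorem isGreatest_col (x : ℕ) : IsGreatest {i | q i ≤ x} (col x) :=
  ⟨Nat.findGreatest_spec (P := fun i => q i ≤ x) (Nat.zero_le x) (Nat.zero_le x),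
    fun i hi => Nat.le_findGreatest ((le_q i).trans hi) hi⟩

/-- The row number of `x`. -/
def row (x : ℕ) : ℕ := x - q (col x)

theorem q_col_add_row (x : ℕ) : q (col x) + row x = x :=
  Nat.add_sub_cancel' (isGreatest_col x).1

/-- The row major order `⊏`. -/
def RowMajor (x y : ℕ) : Prop := row x < row y ∨ (row x = row y ∧ col x < col y)

/-- `Bit a i`: the `i`-th bit in the binary representation of `a` is 1. -/
def Bit (a i : ℕ) : Prop := ¬ 2 ∣ a / 2 ^ i

/-- One binary symbol. -/
inductive OneBinary : ℕ → Type
  | rel : OneBinary 2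

/-- Two binary symbols. -/
inductive TwoBinary : ℕ → Type
  | fst : TwoBinary 2
  | snd : TwoBinary 2

/-- The list `<`. -/
def lt : BuiltIns := BuiltIns.ofNumerical OneBinary fun R =>
  match R with
  | .rel => fun v => v 0 < v 1

/-- The list `<, ⊏`. -/
def ltRowMajor : BuiltIns := BuiltIns.ofNumerical TwoBinary fun R =>
  match R with
  | .fst => fun v => v 0 < v 1
  | .snd => fun v => RowMajor (v 0) (v 1)

/-- The list consisting of `Bit` alone. -/
def bit : BuiltIns := BuiltIns.ofNumerical OneBinary fun R =>
  match R with
  | .rel => fun v => Bit (v 0) (v 1)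

/-- The logic `FO(B)` has the Crane Beach property: every string-language over a finite alphabet
that is definable in `FO(B)` and has a neutral letter is definable in `FO(<)`. -/
def CraneBeachProperty (B : BuiltIns) : Prop :=
  ∀ (A : Type) [Finite A] (L : Set (List A)),
    Definable B L → (∃ e : A, Neutral e L) → Definable lt L

end CraneBeach

namespace CraneBeach

open FirstOrder FirstOrder.Language

/-! Upper bound: `⊏` is definable from `Bit`, since order, addition and multiplication on `[n]` are.
Reading numbers as finite sets, `a < b` is decided at the largest element of the symmetric
difference, so order on `[n]` reduces to order on bit positions, and these in turn to positions of
positions. There the sets involved are so small that the whole order fits into one element of `[n]`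
(`certLT_iff_lt`, `dfn_lt`). Addition is carry lookahead (`dfn_add`).

Multiplication is the school method: count the ones in each column, then propagate carries. Both are
iterations of about `log n` steps on values of size about `log n`. A single element of `[n]` cannot
store such a run, but it can store about `√(log n)` intermediate states, and a second coded path
fills each gap (`Iter.of_seq`). Then `dfn_mul` gives the triangular numbers, hence rows and `⊏`.

Crane Beach property: the numbers below `q (m + 1)` form the full triangle of pairs `r ≤ c ≤ m`, on
which `<` and `⊏` are the two lexicographic orders. Write `w` along row 0 and a neutral letter
elsewhere; membership in the language does not change, and `FO(<,⊏)` on the padded word is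
interpreted in `FO(<)` on `w`, with two variables per element (`exists_wordDfn_pad`).

Strictness: even length is read off bit 0 of the maximum. Were it definable in `FO(<,⊏)`, padding
one-letter words would make the parity of `q (m + 1)` definable in `FO(<)` on orders of length `m +
1`. But this parity keeps changing, while a fixed `FO(<)`-sentence does not distinguish long finite
orders (`exists_realize_iff_of_similar`). -/

/-- The relations `R i` on the universes `{0, …, sz i}` of the structures `S i` are uniformly
definable: a single first-order formula defines all of them. -/
def UDef {L : FirstOrder.Language.{0, 0}} {I : Type} (sz : I → ℕ)
    (S : ∀ i, L.Structure (Fin (sz i + 1))) {Γ : Type} (R : I → (Γ → ℕ) → Prop) : Prop :=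
  ∃ φ : L.Formula Γ, ∀ (i : I) (v : Γ → Fin (sz i + 1)),
    @Formula.Realize L _ (S i) Γ φ v ↔ R i fun g => (v g : ℕ)

/-! ### Closure properties of uniform definability. -/

namespace UDef

variable {L : FirstOrder.Language.{0, 0}} {I : Type} {sz : I → ℕ}
  {S : ∀ i, L.Structure (Fin (sz i + 1))}
  {Γ Δ : Type}

theorem congr {R R' : I → (Γ → ℕ) → Prop} (h : UDef sz S R)
    (e : ∀ i v, (∀ g, v g ≤ sz i) → (R i v ↔ R' i v)) : UDef sz S R' := by
  obtain ⟨φ, hφ⟩ := h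
  exact ⟨φ, fun i v => (hφ i v).trans (e i _ fun g => Nat.lt_succ_iff.1 (v g).2)⟩

theorem not {R : I → (Γ → ℕ) → Prop} (h : UDef sz S R) : UDef sz S fun i v => ¬ R i v := by
  obtain ⟨φ, hφ⟩ := h
  refine ⟨∼φ, fun i v => ?_⟩
  let := S i
  rw [Formula.realize_not, hφ]

theorem imp {R R' : I → (Γ → ℕ) → Prop} (h : UDef sz S R) (h' : UDef sz S R') :
    UDef sz S fun i v => R i v → R' i v := by
  obtain ⟨φ, hφ⟩ := h
  obtain ⟨ψ, hψ⟩ := h'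
  refine ⟨φ.imp ψ, fun i v => ?_⟩
  let := S i
  rw [Formula.realize_imp, hφ, hψ]

theorem and {R R' : I → (Γ → ℕ) → Prop} (h : UDef sz S R) (h' : UDef sz S R') :
    UDef sz S fun i v => R i v ∧ R' i v :=
  (h.imp h'.not).not.congr fun i v _ => by tauto

theorem or {R R' : I → (Γ → ℕ) → Prop} (h : UDef sz S R) (h' : UDef sz S R') :
    UDef sz S fun i v => R i v ∨ R' i v :=
  (h.not.imp h').congr fun i v _ => by tauto

theorem iff {R R' : I → (Γ → ℕ) → Prop} (h : UDef sz S R) (h' : UDef sz S R') :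
    UDef sz S fun i v => R i v ↔ R' i v :=
  ((h.imp h').and (h'.imp h)).congr fun i v _ => by tauto

theorem const (p : Prop) : UDef sz S fun _ (_ : Γ → ℕ) => p := by
  by_cases hp : p
  · refine ⟨⊤, fun i v => ?_⟩
    let := S i
    simp [hp]
  · refine ⟨⊥, fun i v => ?_⟩
    let := S i
    simp [hp, Formula.Realize]

theorem eq (a b : Γ) : UDef sz S fun _ v => v a = v b := by
  refine ⟨(Term.var a).equal (Term.var b), fun i v => ?_⟩
  let := S i
  simp [Formula.realize_equal, Fin.ext_iff]

theorem subst {R : I → (Γ → ℕ) → Prop} (h : UDef sz S R) (f : Γ → Δ) :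
    UDef sz S fun i (v : Δ → ℕ) => R i fun g => v (f g) := by
  obtain ⟨φ, hφ⟩ := h
  refine ⟨φ.relabel f, fun i v => ?_⟩
  let := S i
  rw [Formula.realize_relabel, hφ]
  rfl

theorem all {R : I → (Γ → ℕ) → ℕ → Prop}
    (h : UDef sz S fun i (w : Option Γ → ℕ) => R i (fun g => w (some g)) (w none)) :
    UDef sz S fun i v => ∀ x, x ≤ sz i → R i v x := by
  obtain ⟨φ, hφ⟩ := h
  let g : Option Γ → Γ ⊕ Fin 1 := fun o => o.elim (Sum.inr 0) Sum.inl
  refine ⟨BoundedFormula.all (BoundedFormula.relabel (k := 0) g φ), fun i v => ?_⟩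
  let := S i
  have key : ∀ x : Fin (sz i + 1), (BoundedFormula.relabel (k := 0) g φ).Realize v
      (Fin.snoc (default : Fin 0 → Fin (sz i + 1)) x) ↔ R i (fun g => (v g : ℕ)) x := by
    intro x
    have := hφ i (fun o => o.elim x v)
    refine Iff.trans ?_ this
    rw [BoundedFormula.realize_relabel, Formula.Realize]
    have e1 : (Sum.elim v ((Fin.snoc default x : Fin 1 → Fin (sz i + 1)) ∘ Fin.castAdd 0) ∘ g)
        = fun o => o.elim x v := by
      funext o
      cases o <;> simp [g, Fin.snoc]
    rw [e1]
    exact iff_of_eq (congrArg _ (Subsingleton.elim _ _))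
  rw [Formula.Realize, BoundedFormula.realize_all]
  constructor
  · intro H x hx
    exact (key ⟨x, Nat.lt_succ_of_le hx⟩).1 (H _)
  · intro H x
    exact (key x).2 (H x (Nat.lt_succ_iff.1 x.2))

theorem ex {R : I → (Γ → ℕ) → ℕ → Prop}
    (h : UDef sz S fun i (w : Option Γ → ℕ) => R i (fun g => w (some g)) (w none)) :
    UDef sz S fun i v => ∃ x, x ≤ sz i ∧ R i v x :=
  (all (R := fun i v x => ¬ R i v x) h.not).not.congr fun i v _ => by push Not; rfl

/-- A finite disjunction: `a` is a fixed number rather than an element of the universe, and may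
exceed its size. -/
theorem ex_lt (N : ℕ) {R : I → (Γ → ℕ) → ℕ → Prop} (h : ∀ a, UDef sz S fun i v => R i v a) :
    UDef sz S fun i v => ∃ a, a < N ∧ R i v a := by
  induction N with
  | zero => exact (const False).congr fun i v _ => by simp
  | succ N ih =>
    refine (ih.or (h N)).congr fun i v _ => ?_
    constructor
    · rintro (⟨a, ha, h⟩ | h)
      exacts [⟨a, by omega, h⟩, ⟨N, by omega, h⟩]
    · rintro ⟨a, ha, h⟩
      rcases Nat.lt_succ_iff_lt_or_eq.1 ha with h1 | rfl
      exacts [.inl ⟨a, h1, h⟩, .inr h]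

theorem app₂ {P : I → ℕ → ℕ → Prop}
    (h : UDef sz S fun i (v : Fin 2 → ℕ) => P i (v 0) (v 1)) (a b : Γ) :
    UDef sz S fun i v => P i (v a) (v b) :=
  h.subst ![a, b]

theorem app₃ {P : I → ℕ → ℕ → ℕ → Prop}
    (h : UDef sz S fun i (v : Fin 3 → ℕ) => P i (v 0) (v 1) (v 2)) (a b c : Γ) :
    UDef sz S fun i v => P i (v a) (v b) (v c) :=
  h.subst ![a, b, c]

theorem app₄ {P : I → ℕ → ℕ → ℕ → ℕ → Prop}
    (h : UDef sz S fun i (v : Fin 4 → ℕ) => P i (v 0) (v 1) (v 2) (v 3)) (a b c d : Γ) :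
    UDef sz S fun i v => P i (v a) (v b) (v c) (v d) :=
  h.subst ![a, b, c, d]

theorem app₅ {P : I → ℕ → ℕ → ℕ → ℕ → ℕ → Prop}
    (h : UDef sz S fun i (v : Fin 5 → ℕ) => P i (v 0) (v 1) (v 2) (v 3) (v 4)) (a b c d e : Γ) :
    UDef sz S fun i v => P i (v a) (v b) (v c) (v d) (v e) :=
  h.subst ![a, b, c, d, e]

theorem app₆ {P : I → ℕ → ℕ → ℕ → ℕ → ℕ → ℕ → Prop}
    (h : UDef sz S fun i (v : Fin 6 → ℕ) => P i (v 0) (v 1) (v 2) (v 3) (v 4) (v 5))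
    (a b c d e f : Γ) :
    UDef sz S fun i v => P i (v a) (v b) (v c) (v d) (v e) (v f) :=
  h.subst ![a, b, c, d, e, f]

theorem app₇ {P : I → ℕ → ℕ → ℕ → ℕ → ℕ → ℕ → ℕ → Prop}
    (h : UDef sz S fun i (v : Fin 7 → ℕ) => P i (v 0) (v 1) (v 2) (v 3) (v 4) (v 5) (v 6))
    (a b c d e f g : Γ) :
    UDef sz S fun i v => P i (v a) (v b) (v c) (v d) (v e) (v f) (v g) :=
  h.subst ![a, b, c, d, e, f, g]

end UDef

/-- Uniform definability over the structures `[n]` with built-in predicates `B`. -/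
abbrev BuiltIns.Dfn (B : BuiltIns) {Γ : Type} (R : ℕ → (Γ → ℕ) → Prop) : Prop :=
  UDef (L := B.lang) (fun n => n) B.str R

/-! ### Replacing built-in predicates by their definitions. -/

section Translation

variable {B B' : BuiltIns} (τ : FirstOrder.Language.{0, 0})

/-- Replace the built-in symbols of `B` in terms by those of `B'`; there are no such symbols. -/
def changeFun {k : ℕ} : (τ.sum B.lang).Functions k → (τ.sum B'.lang).Functions k
  | .inl f => .inl f
  | .inr f => Empty.elim f

def changeTerm {α : Type} : (τ.sum B.lang).Term α → (τ.sum B'.lang).Term α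
  | .var a => .var a
  | .func f ts => .func (changeFun τ f) fun i => changeTerm (ts i)

theorem realize_changeTerm {α : Type} {n : ℕ} (S : τ.Structure (Fin (n + 1)))
    (t : (τ.sum B.lang).Term α) (v : α → Fin (n + 1)) :
    (letI := S; letI := B'.str n; (changeTerm (B' := B') τ t).realize v) =
      (letI := S; letI := B.str n; t.realize v) := by
  induction t with
  | var => rfl
  | func f ts ih =>
    rcases f with f | f
    · simp only [changeTerm, Term.realize] at ih ⊢
      simp only [ih]
      rfl
    · exact f.elim

/-- Replace the built-in predicates of `B` by formulas `φ` defining them. -/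
def changeFormula (φ : ∀ k, B.Sym k → B'.lang.Formula (Fin k)) {α : Type} :
    ∀ {k : ℕ}, (τ.sum B.lang).BoundedFormula α k → (τ.sum B'.lang).BoundedFormula α k
  | _, .falsum => .falsum
  | _, .equal t₁ t₂ => .equal (changeTerm τ t₁) (changeTerm τ t₂)
  | _, .rel (.inl R) ts => .rel (.inl R) fun i => changeTerm τ (ts i)
  | k, .rel (.inr R) ts =>
    BoundedFormula.relabel (n := k) (k := 0) id
      (((LHom.sumInr : B'.lang →ᴸ τ.sum B'.lang).onFormula (φ _ R)).subst fun i =>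
        changeTerm τ (ts i))
  | _, .imp f g => .imp (changeFormula φ f) (changeFormula φ g)
  | _, .all f => .all (changeFormula φ f)

theorem realize_changeFormula (φ : ∀ k, B.Sym k → B'.lang.Formula (Fin k))
    (hφ : ∀ k (R : B.Sym k) n (v : Fin k → Fin (n + 1)),
      @Formula.Realize _ _ (B'.str n) _ (φ k R) v ↔ B.interp n R v) {n : ℕ}
    (S : τ.Structure (Fin (n + 1))) {α : Type} {k : ℕ}
    (f : (τ.sum B.lang).BoundedFormula α k) (v : α → Fin (n + 1)) (xs : Fin k → Fin (n + 1)) :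
    (letI := S; letI := B'.str n; (changeFormula τ φ f).Realize v xs) ↔
      (letI := S; letI := B.str n; f.Realize v xs) := by
  induction f with
  | falsum => rfl
  | equal t₁ t₂ =>
    simp only [changeFormula, BoundedFormula.Realize, realize_changeTerm]
  | rel R ts =>
    rcases R with R | R
    · simp only [changeFormula, BoundedFormula.Realize, realize_changeTerm]
      rfl
    · let := S
      let := B'.str n
      simp only [changeFormula]
      rw [BoundedFormula.realize_relabel, BoundedFormula.realize_subst, LHom.onFormula]
      rw [LHom.realize_onBoundedFormula]
      refine Iff.trans (iff_of_eq ?_) ((hφ _ R n _).trans Iff.rfl)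
      · rw [Formula.Realize]
        congr 1
        · funext i
          rw [realize_changeTerm]
          congr 1
        · exact Subsingleton.elim _ _
  | imp f g ihf ihg => simp only [changeFormula, BoundedFormula.Realize, ihf, ihg]
  | all f ih => simp only [changeFormula, BoundedFormula.Realize, ih]

end Translation

theorem AtMostAsExpressive.of_dfn {B B' : BuiltIns}
    (h : ∀ k (R : B.Sym k), ∃ P : ℕ → (Fin k → ℕ) → Prop, B'.Dfn P ∧
      ∀ n (v : Fin k → Fin (n + 1)), P n (fun i => v i) ↔ B.interp n R v) :
    AtMostAsExpressive B B' := by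
  intro τ φ
  choose P hP hPR using h
  choose ψ hψ using hP
  refine ⟨changeFormula τ ψ φ, fun n S => ?_⟩
  exact (realize_changeFormula τ ψ (fun k R n v => (hψ k R n v).trans (hPR k R n v)) S φ _ _).symm

/-! ### Numbers as finite sets, and the order from `Bit`. -/

theorem bit_iff_testBit (a i : ℕ) : Bit a i ↔ a.testBit i = true := by
  rw [Bit, Nat.testBit_eq_decide_div_mod_eq, decide_eq_true_eq]
  omega

theorem Bit.two_pow_le {a i : ℕ} (h : Bit a i) : 2 ^ i ≤ a :=
  Nat.ge_two_pow_of_testBit ((bit_iff_testBit a i).1 h)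

theorem Bit.lt {a i : ℕ} (h : Bit a i) : i < a :=
  i.lt_two_pow_self.trans_le h.two_pow_le

theorem eq_of_bit {a b : ℕ} (h : ∀ i, Bit a i ↔ Bit b i) : a = b := by
  refine Nat.eq_of_testBit_eq fun i => Bool.eq_iff_iff.2 ?_
  rw [← bit_iff_testBit, ← bit_iff_testBit, h]

/-- Every set of numbers below `L` is the set of bits of some number below `2 ^ L`. -/
theorem exists_bit_iff (L : ℕ) (P : ℕ → Prop) : ∃ x < 2 ^ L, ∀ i, Bit x i ↔ i < L ∧ P i := by
  classical
  refine ⟨Nat.ofBits fun i : Fin L => decide (P i), Nat.ofBits_lt_two_pow _, fun i => ?_⟩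
  rw [bit_iff_testBit]
  by_cases h : i < L
  · simp [Nat.testBit_ofBits_lt _ _ h, h]
  · simp [Nat.testBit_ofBits_ge _ _ (not_lt.1 h), h]

/-- The most significant difference decides. In this form only bits of `a` are compared with bits of
`b`, which is what lets the order be computed recursively along `Bit`. -/
theorem lt_iff_exists_bit (a b : ℕ) :
    a < b ↔ ∃ k, Bit b k ∧ ¬ Bit a k ∧ ∀ j, Bit a j → ¬ Bit b j → j < k := by
  have key : ∀ a b : ℕ, a < b → ∃ k, Bit b k ∧ ¬ Bit a k ∧ ∀ j, Bit a j → ¬ Bit b j → j < k := by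
    intro a b h
    obtain ⟨k, hk, hj⟩ := Nat.exists_most_significant_bit (n := a ^^^ b)
      (fun h0 => h.ne (Nat.xor_eq_zero_iff.1 h0))
    simp only [Nat.testBit_xor, bne_iff_ne, bne_eq_false_iff_eq, ne_eq] at hk hj
    simp only [bit_iff_testBit]
    rcases hb : b.testBit k with _ | _
    · have ha : a.testBit k = true := by
        rw [hb] at hk
        simpa using hk
      exact absurd (Nat.lt_of_testBit k hb ha fun j h => (hj j h).symm) h.not_gt
    · refine ⟨k, hb, fun ha => hk (ha.trans hb.symm), fun j ha hb' => ?_⟩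
      rcases lt_trichotomy j k with h | rfl | h
      exacts [h, absurd hb hb', absurd ((hj j h).symm.trans ha) hb']
  refine ⟨key a b, ?_⟩
  rintro ⟨k, hb, ha, h⟩
  rcases lt_trichotomy a b with h1 | rfl | h1
  · exact h1
  · exact absurd hb ha
  · obtain ⟨l, hal, hbl, hl⟩ := key b a h1
    exact absurd (h l hal hbl) (hl k hb ha).not_gt

/-- Comparison of binary representations, with respect to a given relation on bit positions. -/
def BitLex (n : ℕ) (R : ℕ → ℕ → Prop) (a b : ℕ) : Prop :=
  ∃ k, k ≤ n ∧ Bit b k ∧ ¬ Bit a k ∧ ∀ j, j ≤ n → Bit a j → ¬ Bit b j → R j k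

/-- `i` belongs to some set coded by an element of the set coded by `F` that does not contain `j`. -/
def Separates (n F i j : ℕ) : Prop := ∃ s, s ≤ n ∧ Bit F s ∧ Bit s i ∧ ¬ Bit s j

/-- On the transitive set coded by `U`, the set coded by `F` certifies the natural order. -/
def IsOrderCert (n F U : ℕ) : Prop :=
  (∀ i, i ≤ n → ∀ j, j ≤ n → Bit U i → Bit i j → Bit U j) ∧
  ∀ i, i ≤ n → ∀ j, j ≤ n → Bit U i → Bit U j → (Separates n F i j ↔ BitLex n (Separates n F) i j)

/-- Every certificate is sound, by induction along `Bit`, so guessing one existentially is harmless;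
one large enough exists only for doubly logarithmic arguments. -/
def CertLT (n i j : ℕ) : Prop :=
  ∃ F, F ≤ n ∧ ∃ U, U ≤ n ∧ IsOrderCert n F U ∧ Bit U i ∧ Bit U j ∧ Separates n F i j

theorem dfn_bit {Γ : Type} (a b : Γ) : bit.Dfn fun _ v => Bit (v a) (v b) := by
  refine ⟨Relations.formula₂ (L := bit.lang) (show bit.Sym 2 from OneBinary.rel)
    (Term.var a) (Term.var b), fun n v => ?_⟩
  rfl

theorem dfn_bitLex {R : ℕ → ℕ → ℕ → Prop} (h : bit.Dfn fun n (v : Fin 2 → ℕ) => R n (v 0) (v 1)) :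
    bit.Dfn fun n (v : Fin 2 → ℕ) => BitLex n (R n) (v 0) (v 1) :=
  .ex <| .and (dfn_bit _ _) <| .and (dfn_bit _ _).not <| .all <|
    .imp (dfn_bit _ _) <| .imp (dfn_bit _ _).not (h.app₂ _ _)

theorem dfn_separates : bit.Dfn fun n (v : Fin 3 → ℕ) => Separates n (v 0) (v 1) (v 2) :=
  .ex <| .and (dfn_bit _ _) <| .and (dfn_bit _ _) (dfn_bit _ _).not

theorem dfn_certLT : bit.Dfn fun n (v : Fin 2 → ℕ) => CertLT n (v 0) (v 1) := by
  refine .ex <| .ex <| .and (.and ?_ ?_) <| .and (dfn_bit _ _) <| .and (dfn_bit _ _) <|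
    dfn_separates.app₃ _ _ _
  · exact .all <| .all <| .imp (dfn_bit _ _) <| .imp (dfn_bit _ _) (dfn_bit _ _)
  · refine .all <| .all <| .imp (dfn_bit _ _) <| .imp (dfn_bit _ _) <|
      .iff (dfn_separates.app₃ _ _ _) ?_
    exact .ex <| .and (dfn_bit _ _) <| .and (dfn_bit _ _).not <| .all <|
      .imp (dfn_bit _ _) <| .imp (dfn_bit _ _).not (dfn_separates.app₃ _ _ _)

theorem bitLex_iff_lt {n : ℕ} {R : ℕ → ℕ → Prop} {a b : ℕ} (ha : a ≤ n) (hb : b ≤ n)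
    (h : ∀ j k, Bit a j → Bit b k → (R j k ↔ j < k)) : BitLex n R a b ↔ a < b := by
  rw [lt_iff_exists_bit]
  constructor
  · rintro ⟨k, -, h1, h2, h3⟩
    exact ⟨k, h1, h2, fun j hj hj' => (h j k hj h1).1 (h3 j (hj.lt.le.trans ha) hj hj')⟩
  · rintro ⟨k, h1, h2, h3⟩
    exact ⟨k, h1.lt.le.trans hb, h1, h2, fun j _ hj hj' => (h j k hj h1).2 (h3 j hj hj')⟩

/-- Members of `i` and `j` stay in `U` by transitivity, and members of `i` are smaller than `i`; so
the recursion for `<` forces the relation. -/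
theorem IsOrderCert.separates_iff {n F U : ℕ} (h : IsOrderCert n F U) (hU : U ≤ n) {i j : ℕ}
    (hi : Bit U i) (hj : Bit U j) : Separates n F i j ↔ i < j := by
  induction i using Nat.strong_induction_on generalizing j with
  | h i ih =>
    have hi' := hi.lt.le.trans hU
    have hj' := hj.lt.le.trans hU
    rw [h.2 i hi' j hj' hi hj]
    exact bitLex_iff_lt hi' hj' fun l k hl hk =>
      ih l hl.lt (h.1 i hi' l (hl.lt.le.trans hi') hi hl) (h.1 j hj' k (hk.lt.le.trans hj') hj hk)

theorem exists_isOrderCert {n p : ℕ} (hp : 2 ^ 2 ^ p ≤ n) :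
    ∃ F ≤ n, ∃ U ≤ n, IsOrderCert n F U ∧ ∀ i, Bit U i ↔ i ≤ p := by
  -- The sets coded by `2 ^ e - 1` are the initial segments, and these separate exactly the pairs `i
  -- < j`.
  obtain ⟨F, hF, hFb⟩ := exists_bit_iff (2 ^ p) fun s => ∃ e, e ≤ p ∧ s = 2 ^ e - 1
  obtain ⟨U, hU, hUb⟩ := exists_bit_iff (p + 1) fun _ => True
  have hU' : ∀ i, Bit U i ↔ i ≤ p := fun i => by rw [hUb]; simp
  have hFn : F ≤ n := hF.le.trans hp
  have hpp : p + 1 ≤ 2 ^ p := p.lt_two_pow_self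
  refine ⟨F, hFn, U, hU.le.trans ((Nat.pow_le_pow_right (by norm_num) hpp).trans hp), ?_, hU'⟩
  have hpow : ∀ e i, Bit (2 ^ e - 1) i ↔ i < e := fun e i => by
    rw [bit_iff_testBit, Nat.testBit_two_pow_sub_one, decide_eq_true_eq]
  have hsep : ∀ i j, j ≤ p → (Separates n F i j ↔ i < j) := by
    intro i j hj
    constructor
    · rintro ⟨s, -, hs, hi, hj'⟩
      obtain ⟨-, e, he, rfl⟩ := (hFb s).1 hs
      rw [hpow] at hi hj'
      omega
    · intro hij
      have hlt : 2 ^ j - 1 < 2 ^ p :=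
        (Nat.sub_lt (by positivity) one_pos).trans_le (Nat.pow_le_pow_right (by norm_num) hj)
      have hbit : Bit F (2 ^ j - 1) := (hFb _).2 ⟨hlt, j, hj, rfl⟩
      exact ⟨2 ^ j - 1, hbit.lt.le.trans hFn, hbit, (hpow _ _).2 hij, fun h => by
        simp [hpow] at h⟩
  refine ⟨fun i _ j _ hi hj => (hU' j).2 (hj.lt.le.trans ((hU' i).1 hi)),
    fun i hi j hj hi' hj' => ?_⟩
  rw [hU'] at hi' hj'
  rw [hsep i j hj', bitLex_iff_lt hi hj]
  exact fun l k _ hk => hsep l k (hk.lt.le.trans hj')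

theorem certLT_iff_lt {n i j : ℕ} (hj : 2 ^ 2 ^ j ≤ n) :
    CertLT n i j ↔ i < j := by
  constructor
  · rintro ⟨F, -, U, hU, h, hi, hj, hs⟩
    exact (h.separates_iff hU hi hj).1 hs
  · intro hij
    obtain ⟨F, hF, U, hU, h, hb⟩ := exists_isOrderCert hj
    have hi' := (hb i).2 hij.le
    have hj' := (hb j).2 le_rfl
    exact ⟨F, hF, U, hU, h, hi', hj', (h.separates_iff hU hi' hj').2 hij⟩

/-- The natural order is definable from `Bit`. -/
theorem dfn_lt {Γ : Type} (a b : Γ) : bit.Dfn fun _ v => v a < v b := by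
  refine ((dfn_bitLex (dfn_bitLex dfn_certLT)).app₂ a b).congr fun n v hv => ?_
  -- Descending twice along `Bit` from an element of `[n]` reaches numbers `m` with `2 ^ 2 ^ m ≤ n`,
  -- where certificates exist.
  have pow_le : ∀ {x y m : ℕ}, Bit x y → 2 ^ x ≤ m → 2 ^ 2 ^ y ≤ m := fun hb hx =>
    (Nat.pow_le_pow_right (by norm_num) hb.two_pow_le).trans hx
  exact bitLex_iff_lt (hv a) (hv b) fun j k hj hk =>
    bitLex_iff_lt (hj.lt.le.trans (hv a)) (hk.lt.le.trans (hv b)) fun l m _ hm =>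
      certLT_iff_lt (pow_le hm (hk.two_pow_le.trans (hv b)))

theorem dfn_const_le {Γ : Type} (c : ℕ) (a : Γ) : bit.Dfn fun _ v => c ≤ v a := by
  induction c generalizing Γ with
  | zero => exact (UDef.const True).congr fun n v _ => by simp
  | succ c ih =>
    have : bit.Dfn fun n (v : Γ → ℕ) => ∃ x, x ≤ n ∧ (x < v a ∧ c ≤ x) :=
      .ex <| .and (dfn_lt _ _) (ih _)
    refine this.congr fun n v hv => ⟨?_, fun h => ⟨c, ?_, h, le_rfl⟩⟩
    · rintro ⟨x, -, h1, h2⟩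
      omega
    · exact (Nat.le_succ c).trans (h.trans (hv a))

theorem dfn_eq_const {Γ : Type} (c : ℕ) (a : Γ) : bit.Dfn fun _ v => v a = c :=
  ((dfn_const_le c a).and (dfn_const_le (c + 1) a).not).congr fun n v _ => by omega

theorem dfn_size_lt {Γ : Type} (c : ℕ) : bit.Dfn fun n (_ : Γ → ℕ) => n < c := by
  have : bit.Dfn fun n (_ : Γ → ℕ) => ∃ x, x ≤ n ∧ c ≤ x := .ex <| dfn_const_le _ _
  refine this.not.congr fun n v _ => ?_
  rw [← not_le, not_iff_not]
  exact ⟨fun ⟨x, h1, h2⟩ => h2.trans h1, fun h => ⟨n, le_rfl, h⟩⟩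

theorem dfn_succ {Γ : Type} (a b : Γ) : bit.Dfn fun _ v => v a = v b + 1 := by
  have : bit.Dfn fun n (v : Γ → ℕ) => v b < v a ∧ ∀ x, x ≤ n → v b < x → ¬ x < v a :=
    .and (dfn_lt _ _) <| .all <| .imp (dfn_lt _ _) (dfn_lt _ _).not
  refine this.congr fun n v hv => ⟨fun ⟨h1, h2⟩ => ?_, fun h => ⟨by omega, by omega⟩⟩
  have := h2 (v b + 1) (h1.trans_le (hv a)) (Nat.lt_succ_self _)
  omega

/-! ### Addition from `Bit`. -/

theorem bit_iff_mod (a i : ℕ) : Bit a i ↔ a / 2 ^ i % 2 = 1 := by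
  rw [Bit]
  omega

/-- Carry lookahead. -/
theorem carry_iff (a b i : ℕ) : 2 ^ i ≤ a % 2 ^ i + b % 2 ^ i ↔
    ∃ j < i, Bit a j ∧ Bit b j ∧ ∀ k, j < k → k < i → Bit a k ∨ Bit b k := by
  induction i with
  | zero => simp [Nat.mod_one]
  | succ i ih =>
    have h1 : (∃ j < i + 1, Bit a j ∧ Bit b j ∧ ∀ k, j < k → k < i + 1 → Bit a k ∨ Bit b k) ↔
        (Bit a i ∧ Bit b i) ∨ ((Bit a i ∨ Bit b i) ∧
          ∃ j < i, Bit a j ∧ Bit b j ∧ ∀ k, j < k → k < i → Bit a k ∨ Bit b k) := by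
      constructor
      · rintro ⟨j, hj, ha, hb, h⟩
        rcases Nat.lt_succ_iff_lt_or_eq.1 hj with hj | rfl
        · exact .inr ⟨h i hj (Nat.lt_succ_self i), j, hj, ha, hb, fun k h1 h2 => h k h1 (by omega)⟩
        · exact .inl ⟨ha, hb⟩
      · rintro (⟨ha, hb⟩ | ⟨hi, j, hj, ha, hb, h⟩)
        · exact ⟨i, Nat.lt_succ_self i, ha, hb, fun k h1 h2 => by omega⟩
        · refine ⟨j, by omega, ha, hb, fun k h1 h2 => ?_⟩
          rcases Nat.lt_succ_iff_lt_or_eq.1 h2 with h2 | rfl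
          exacts [h k h1 h2, hi]
    rw [h1, ← ih, bit_iff_mod, bit_iff_mod, Nat.mod_pow_succ, Nat.mod_pow_succ, pow_succ]
    have ha := Nat.mod_lt a (Nat.two_pow_pos i)
    have hb := Nat.mod_lt b (Nat.two_pow_pos i)
    rcases Nat.mod_two_eq_zero_or_one (a / 2 ^ i) with h | h <;>
    rcases Nat.mod_two_eq_zero_or_one (b / 2 ^ i) with h' | h' <;>
    rw [h, h'] <;> simp <;> omega

/-- The nested equivalence is the exclusive or of the two bits and the carry, since two negations
cancel. -/
theorem bit_add_iff (a b i : ℕ) : Bit (a + b) i ↔ ((Bit a i ↔ Bit b i) ↔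
    ∃ j < i, Bit a j ∧ Bit b j ∧ ∀ k, j < k → k < i → Bit a k ∨ Bit b k) := by
  rw [← carry_iff, bit_iff_mod, bit_iff_mod, bit_iff_mod, Nat.add_div (Nat.two_pow_pos i)]
  split_ifs with h <;> simp only [h, iff_true, iff_false] <;> omega

theorem dfn_add {Γ : Type} (c a b : Γ) : bit.Dfn fun _ v => v c = v a + v b := by
  have : bit.Dfn fun n (v : Γ → ℕ) => ∀ i, i ≤ n → (Bit (v c) i ↔ ((Bit (v a) i ↔ Bit (v b) i) ↔
      ∃ j, j ≤ n ∧ j < i ∧ Bit (v a) j ∧ Bit (v b) j ∧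
        ∀ k, k ≤ n → j < k → k < i → Bit (v a) k ∨ Bit (v b) k)) :=
    .all <| .iff (dfn_bit _ _) <| .iff (.iff (dfn_bit _ _) (dfn_bit _ _)) <| .ex <|
      .and (dfn_lt _ _) <| .and (dfn_bit _ _) <| .and (dfn_bit _ _) <| .all <|
      .imp (dfn_lt _ _) <| .imp (dfn_lt _ _) <| .or (dfn_bit _ _) (dfn_bit _ _)
  refine this.congr fun n v hv => ?_
  have key : ∀ i, i ≤ n → (Bit (v a + v b) i ↔ ((Bit (v a) i ↔ Bit (v b) i) ↔
      ∃ j, j ≤ n ∧ j < i ∧ Bit (v a) j ∧ Bit (v b) j ∧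
        ∀ k, k ≤ n → j < k → k < i → Bit (v a) k ∨ Bit (v b) k)) := by
    intro i hi
    rw [bit_add_iff]
    refine iff_congr Iff.rfl ⟨?_, ?_⟩
    · rintro ⟨j, hj, h1, h2, h3⟩
      exact ⟨j, by omega, hj, h1, h2, fun k _ => h3 k⟩
    · rintro ⟨j, -, hj, h1, h2, h3⟩
      exact ⟨j, hj, h1, h2, fun k hk hk' => h3 k (by omega) hk hk'⟩
  constructor
  · intro H
    refine eq_of_bit fun i => ?_
    by_cases hi : i ≤ n
    · rw [H i hi, key i hi]
    · refine iff_of_false (fun h => hi (h.lt.le.trans (hv c))) fun h => ?_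
      have h1 := h.two_pow_le
      have h2 : 2 ^ (n + 1) ≤ 2 ^ i := Nat.pow_le_pow_right (by norm_num) (by omega)
      have h3 : n < 2 ^ n := n.lt_two_pow_self
      have := hv a
      have := hv b
      rw [pow_succ] at h2
      omega
  · intro h i hi
    rw [h, key i hi]

/-! ### Paths coded by numbers -/

/-- The number coded by the `s` bits of `z` from position `m` on. -/
def block (z s m : ℕ) : ℕ := z / 2 ^ m % 2 ^ s

theorem bit_block (z s m b : ℕ) : Bit (block z s m) b ↔ b < s ∧ Bit z (m + b) := by
  rw [bit_iff_testBit, bit_iff_testBit, block, Nat.testBit_mod_two_pow, Nat.testBit_div_two_pow,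
    add_comm m b]
  simp

theorem dfn_block {Γ : Type} (x z s m : Γ) :
    bit.Dfn fun _ v => v x = block (v z) (v s) (v m) := by
  have : bit.Dfn fun n (v : Γ → ℕ) => ∀ b, b ≤ n →
      (Bit (v x) b ↔ b < v s ∧ ∃ p, p ≤ n ∧ p = v m + b ∧ Bit (v z) p) :=
    .all <| .iff (dfn_bit _ _) <| .and (dfn_lt _ _) <| .ex <| .and (dfn_add _ _ _) (dfn_bit _ _)
  refine this.congr fun n v hv => ?_
  have key : ∀ b, (∃ p, p ≤ n ∧ p = v m + b ∧ Bit (v z) p) ↔ Bit (v z) (v m + b) := fun b =>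
    ⟨fun ⟨p, _, h, h'⟩ => h ▸ h', fun h => ⟨_, h.lt.le.trans (hv z), rfl, h⟩⟩
  simp only [key, ← bit_block]
  refine ⟨fun H => eq_of_bit fun b => ?_, fun H b _ => by rw [H]⟩
  by_cases hb : b ≤ n
  · exact H b hb
  · refine iff_of_false (fun h => hb (h.lt.le.trans (hv x))) fun h => ?_
    rw [bit_block] at h
    exact hb (h.1.le.trans (hv s))

/-- There is an `R`-path from `(x₁, x₂)` to `(y₁, y₂)` that is coded by elements of `[n]`: its nodes
are the blocks of length `s` of `z₁` and `z₂` at the positions in the set coded by `M`. -/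
def CodedPath (n : ℕ) (R : ℕ → ℕ → ℕ → ℕ → Prop) (x₁ x₂ y₁ y₂ : ℕ) : Prop :=
  ∃ s, s ≤ n ∧ ∃ M, M ≤ n ∧ ∃ z₁, z₁ ≤ n ∧ ∃ z₂, z₂ ≤ n ∧ ∃ o, o ≤ n ∧ ∃ e, e ≤ n ∧
    o = 0 ∧ o < s ∧ Bit M o ∧ x₁ = block z₁ s o ∧ x₂ = block z₂ s o ∧
    y₁ = block z₁ s e ∧ y₂ = block z₂ s e ∧
    ∀ m, m ≤ n → Bit M m → m = e ∨ ∃ m', m' ≤ n ∧ m' = m + s ∧ Bit M m' ∧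
      ∃ v₁, v₁ ≤ n ∧ ∃ v₂, v₂ ≤ n ∧ ∃ w₁, w₁ ≤ n ∧ ∃ w₂, w₂ ≤ n ∧
        v₁ = block z₁ s m ∧ v₂ = block z₂ s m ∧ w₁ = block z₁ s m' ∧ w₂ = block z₂ s m' ∧
        R v₁ v₂ w₁ w₂

theorem dfn_codedPath {R : ℕ → ℕ → ℕ → ℕ → ℕ → ℕ → ℕ → ℕ → Prop}
    (h : bit.Dfn fun n (v : Fin 7 → ℕ) => R n (v 0) (v 1) (v 2) (v 3) (v 4) (v 5) (v 6)) :
    bit.Dfn fun n (v : Fin 7 → ℕ) =>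
      CodedPath n (R n (v 0) (v 1) (v 2)) (v 3) (v 4) (v 5) (v 6) :=
  .ex <| .ex <| .ex <| .ex <| .ex <| .ex <| .and (dfn_eq_const _ _) <| .and (dfn_lt _ _) <|
    .and (dfn_bit _ _) <| .and (dfn_block _ _ _ _) <| .and (dfn_block _ _ _ _) <|
    .and (dfn_block _ _ _ _) <| .and (dfn_block _ _ _ _) <| .all <| .imp (dfn_bit _ _) <|
    .or (.eq _ _) <| .ex <| .and (dfn_add _ _ _) <| .and (dfn_bit _ _) <|
    .ex <| .ex <| .ex <| .ex <| .and (dfn_block _ _ _ _) <| .and (dfn_block _ _ _ _) <|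
    .and (dfn_block _ _ _ _) <| .and (dfn_block _ _ _ _) <| h.app₇ _ _ _ _ _ _ _

/-- Positions in `M` increase by `s > 0` and are bounded, and only `e` may lack a successor; so the
walk from `0` must reach `e`. -/
theorem CodedPath.invariant {n : ℕ} {R : ℕ → ℕ → ℕ → ℕ → Prop} {x₁ x₂ y₁ y₂ : ℕ}
    (h : CodedPath n R x₁ x₂ y₁ y₂) {P : ℕ → ℕ → Prop}
    (hP : ∀ a b c d, R a b c d → P a b → P c d) (hx : P x₁ x₂) : P y₁ y₂ := by
  obtain ⟨s, -, M, hM, z₁, -, z₂, -, o, -, e, -, rfl, hs, hMo, rfl, rfl, rfl, rfl, H⟩ := h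
  have key : ∀ d m, n ≤ m + d → Bit M m → P (block z₁ s m) (block z₂ s m) →
      P (block z₁ s e) (block z₂ s e) := by
    intro d
    induction d with
    | zero =>
      intro m hm hb _
      have := hb.lt
      omega
    | succ d ih =>
      intro m hm hb hp
      rcases H m (hb.lt.le.trans hM) hb with
        rfl | ⟨_, -, rfl, hb', _, -, _, -, _, -, _, -, rfl, rfl, rfl, rfl, hR⟩
      · exact hp
      · exact ih _ (by omega) hb' (hP _ _ _ _ hR hp)
  exact key n 0 (by omega) hMo hx

theorem CodedPath.of_chain {n : ℕ} {R : ℕ → ℕ → ℕ → ℕ → Prop} {s t : ℕ} (hs : 0 < s)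
    (hn : 2 ^ (s * (t + 1)) ≤ n) (p₁ p₂ : ℕ → ℕ)
    (hR : ∀ i < t, R (p₁ i) (p₂ i) (p₁ (i + 1)) (p₂ (i + 1)))
    (h₁ : ∀ i ≤ t, p₁ i < 2 ^ s) (h₂ : ∀ i ≤ t, p₂ i < 2 ^ s) :
    CodedPath n R (p₁ 0) (p₂ 0) (p₁ t) (p₂ t) := by
  obtain ⟨M, hM, hMb⟩ := exists_bit_iff (s * (t + 1)) fun m => s ∣ m
  have code : ∀ p : ℕ → ℕ, (∀ i ≤ t, p i < 2 ^ s) →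
      ∃ z < 2 ^ (s * (t + 1)), ∀ i ≤ t, p i = block z s (s * i) := by
    intro p hp
    -- Concatenate the values as blocks of `s` bits.
    obtain ⟨z, hz, hzb⟩ := exists_bit_iff (s * (t + 1)) fun m => Bit (p (m / s)) (m % s)
    refine ⟨z, hz, fun i hi => eq_of_bit fun b => ?_⟩
    rw [bit_block, hzb]
    by_cases hb : b < s
    · have h1 : s * i + b < s * (t + 1) := by
        have := Nat.mul_le_mul_left s hi
        rw [mul_add]
        omega
      simp only [hb, h1, true_and]
      rw [Nat.mul_add_div hs, Nat.mul_add_mod, Nat.div_eq_of_lt hb, Nat.mod_eq_of_lt hb, add_zero]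
    · refine iff_of_false (fun h => ?_) fun h => hb h.1
      have := h.two_pow_le.trans_lt (hp i hi)
      exact hb ((Nat.pow_lt_pow_iff_right (by norm_num)).1 this)
  obtain ⟨z₁, hz₁, e₁⟩ := code p₁ h₁
  obtain ⟨z₂, hz₂, e₂⟩ := code p₂ h₂
  have hle : s * (t + 1) ≤ n := (Nat.lt_two_pow_self).le.trans hn
  have hst : s * (t + 1) = s * t + s := by ring
  have hsn : 2 ^ s ≤ n := (Nat.pow_le_pow_right (by norm_num) (by omega)).trans hn
  have start₁ := e₁ 0 (Nat.zero_le t)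
  have start₂ := e₂ 0 (Nat.zero_le t)
  rw [mul_zero] at start₁ start₂
  refine ⟨s, by omega, M, by omega, z₁, by omega, z₂, by omega, 0, by omega, s * t, by omega, rfl,
    hs, (hMb 0).2 ⟨by positivity, dvd_zero s⟩, start₁, start₂, e₁ t le_rfl, e₂ t le_rfl, ?_⟩
  intro m _ hm
  obtain ⟨hlt, i, rfl⟩ := (hMb m).1 hm
  have hi : i < t + 1 := lt_of_mul_lt_mul_left hlt (Nat.zero_le s)
  rcases Nat.lt_succ_iff_lt_or_eq.1 hi with hi | rfl
  · have h1 : s * (i + 1) < s * (t + 1) := Nat.mul_lt_mul_of_pos_left (by omega) hs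
    refine .inr ⟨s * (i + 1), by omega, by ring, (hMb _).2 ⟨h1, dvd_mul_right _ _⟩,
      p₁ i, ?_, p₂ i, ?_, p₁ (i + 1), ?_, p₂ (i + 1), ?_, e₁ i hi.le, e₂ i hi.le,
      e₁ (i + 1) hi, e₂ (i + 1) hi, hR i hi⟩
    exacts [(h₁ i hi.le).le.trans hsn, (h₂ i hi.le).le.trans hsn, (h₁ _ hi).le.trans hsn,
      (h₂ _ hi).le.trans hsn]
  · exact .inl rfl

/-- The `j`-th value of a sequence that starts with `0` and whose steps are described by `G`. -/
def Iter (n : ℕ) (G : ℕ → ℕ → ℕ → Prop) (j y : ℕ) : Prop :=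
  ∃ o, o ≤ n ∧ o = 0 ∧
    CodedPath n (CodedPath n fun i v i' v' => i' = i + 1 ∧ G i v v') o o j y

theorem dfn_iter {G : ℕ → ℕ → ℕ → ℕ → ℕ → ℕ → ℕ → Prop}
    (h : bit.Dfn fun n (v : Fin 6 → ℕ) => G n (v 0) (v 1) (v 2) (v 3) (v 4) (v 5)) :
    bit.Dfn fun n (v : Fin 5 → ℕ) => Iter n (G n (v 0) (v 1) (v 2)) (v 3) (v 4) := by
  have step : bit.Dfn fun n (v : Fin 7 → ℕ) =>
      v 5 = v 3 + 1 ∧ G n (v 0) (v 1) (v 2) (v 3) (v 4) (v 6) :=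
    .and (dfn_succ _ _) (h.app₆ _ _ _ _ _ _)
  have := dfn_codedPath
    (R := fun n a b c => CodedPath n fun i v i' v' => i' = i + 1 ∧ G n a b c i v v')
    (dfn_codedPath (R := fun n a b c i v i' v' => i' = i + 1 ∧ G n a b c i v v') step)
  exact .ex <| .and (dfn_eq_const _ _) <|
    this.subst ![some 0, some 1, some 2, none, none, some 3, some 4]

theorem Iter.invariant {n : ℕ} {G : ℕ → ℕ → ℕ → Prop} {j y : ℕ} (h : Iter n G j y)
    {P : ℕ → ℕ → Prop} (h0 : P 0 0) (hP : ∀ i v v', G i v v' → P i v → P (i + 1) v') : P j y := by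
  obtain ⟨_, -, rfl, h⟩ := h
  refine h.invariant (fun a b c d h' => h'.invariant ?_) h0
  rintro a b _ d ⟨rfl, hG⟩
  exact hP _ _ _ hG

/-- The outer path visits every `t`-th state, cut off at `j`, and each inner path supplies the at
most `t` steps between; so paths of length `t` give `t * t` steps. -/
theorem Iter.of_seq {n : ℕ} {G : ℕ → ℕ → ℕ → Prop} {s t j : ℕ} (hs : 0 < s)
    (hn : 2 ^ (s * (t + 1)) ≤ n) (f : ℕ → ℕ) (h0 : f 0 = 0) (hj : j < 2 ^ s) (hjt : j ≤ t * t)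
    (hf : ∀ i ≤ j, f i < 2 ^ s) (hG : ∀ i < j, G i (f i) (f (i + 1))) : Iter n G j (f j) := by
  refine ⟨0, Nat.zero_le n, rfl, ?_⟩
  have key := CodedPath.of_chain (R := CodedPath n fun i v i' v' => i' = i + 1 ∧ G i v v') hs hn
    (fun i => min (t * i) j) (fun i => f (min (t * i) j)) ?_ ?_ ?_
  · simpa [h0, hjt] using key
  · intro i _
    obtain ⟨d, hd⟩ := Nat.exists_eq_add_of_le
      (show min (t * i) j ≤ min (t * (i + 1)) j from min_le_min_right _ (by gcongr; omega))
    have hdt : d ≤ t := by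
      rw [mul_add] at hd
      omega
    have hdj : min (t * i) j + d ≤ j := by omega
    have := CodedPath.of_chain (R := fun i v i' v' => i' = i + 1 ∧ G i v v') (t := d) hs
      ((Nat.pow_le_pow_right (by norm_num) (by gcongr)).trans hn)
      (fun k => min (t * i) j + k) (fun k => f (min (t * i) j + k))
      (fun k hk => ⟨rfl, hG _ (by omega)⟩) (fun k hk => by omega) (fun k hk => hf _ (by omega))
    simpa [← hd] using this
  · intro i _
    exact (min_le_right _ _).trans_lt hj
  · intro i _
    exact hf _ (min_le_right _ _)

/-! ### Multiplication -/

open Classical in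
/-- The number of `j < i` such that `2 ^ j` and `2 ^ (k - j)` occur in the binary expansions of `a`
and `b`. -/
noncomputable def convCount (a b k i : ℕ) : ℕ :=
  ∑ j ∈ Finset.range i, if Bit a j ∧ ∃ l, k = j + l ∧ Bit b l then 1 else 0

/-- The `k`-th digit of the product of `a` and `b` before carrying. -/
noncomputable def conv (a b k : ℕ) : ℕ := convCount a b k (k + 1)

theorem convCount_le (a b k i : ℕ) : convCount a b k i ≤ i := by
  classical
  refine (Finset.sum_le_card_nsmul _ _ 1 fun j _ => ?_).trans (by simp)
  split_ifs <;> simp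

theorem sum_bit_mul_two_pow (a N : ℕ) [DecidablePred (Bit a)] :
    ∑ i ∈ Finset.range N, (if Bit a i then 1 else 0) * 2 ^ i = a % 2 ^ N := by
  induction N with
  | zero => simp [Nat.mod_one]
  | succ N ih =>
    rw [Finset.sum_range_succ, ih, Nat.mod_pow_succ]
    have := bit_iff_mod a N
    rcases Nat.mod_two_eq_zero_or_one (a / 2 ^ N) with h | h <;> simp [this, h]

open Polynomial in
theorem sum_conv_mul_two_pow {a b K : ℕ} (hK : ∀ i j, Bit a i → Bit b j → i + j < K) :
    ∑ k ∈ Finset.range K, conv a b k * 2 ^ k = a * b := by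
  classical
  -- The binary expansion as a polynomial: the digits before carrying are the coefficients of a
  -- product, evaluated at 2.
  let p : ℕ → ℕ[X] := fun a => ∑ i ∈ Finset.range a, C (if Bit a i then 1 else 0) * X ^ i
  have hp : ∀ a, (p a).eval 2 = a := fun a => by
    simp only [p, eval_finsetSum, eval_mul, eval_C, eval_pow, eval_X]
    rw [sum_bit_mul_two_pow, Nat.mod_eq_of_lt a.lt_two_pow_self]
  have hc : ∀ a i, (p a).coeff i = if Bit a i then 1 else 0 := fun a i => by
    simp only [p, finsetSum_coeff, coeff_C_mul_X_pow]
    rw [Finset.sum_ite_eq (Finset.range a) i]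
    split_ifs with h1 h2 h2
    · rfl
    · rfl
    · exact absurd (Finset.mem_range.2 h2.lt) h1
    · rfl
  have hconv : ∀ k, (p a * p b).coeff k = conv a b k := fun k => by
    rw [coeff_mul, Finset.Nat.sum_antidiagonal_eq_sum_range_succ_mk, conv, convCount]
    refine Finset.sum_congr rfl fun j hj => ?_
    have hjk : j ≤ k := Nat.lt_succ_iff.1 (Finset.mem_range.1 hj)
    have : (∃ l, k = j + l ∧ Bit b l) ↔ Bit b (k - j) :=
      ⟨fun ⟨l, h, h'⟩ => by rwa [h, Nat.add_sub_cancel_left], fun h => ⟨k - j, by omega, h⟩⟩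
    rw [hc, hc, this]
    split_ifs <;> simp_all
  have h0 : ∀ k, K ≤ k → conv a b k = 0 := fun k hk => by
    rw [conv, convCount]
    refine Finset.sum_eq_zero fun j _ => if_neg ?_
    rintro ⟨h1, l, rfl, h2⟩
    exact absurd (hK j l h1 h2) (by omega)
  have := eval_eq_sum_range' (p := p a * p b)
    (n := max K ((p a * p b).natDegree + 1)) (by omega) 2
  rw [eval_mul, hp, hp] at this
  rw [this]
  simp only [hconv]
  refine Finset.sum_subset (Finset.range_subset_range.2 (le_max_left _ _)) fun k _ hk => ?_
  rw [h0 k (by simpa using hk), zero_mul]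

/-- One step of counting for `convCount`. -/
def CountStep (n a b k i v v' : ℕ) : Prop :=
  ((Bit a i ∧ ∃ l, l ≤ n ∧ k = i + l ∧ Bit b l) ∧ v' = v + 1) ∨
    (¬ (Bit a i ∧ ∃ l, l ≤ n ∧ k = i + l ∧ Bit b l) ∧ v' = v)

def IsConv (n a b k y : ℕ) : Prop := ∃ j, j ≤ n ∧ j = k + 1 ∧ Iter n (CountStep n a b k) j y

/-- One step of adding up the columns: the carry `v` is replaced by `v'`, and the digit is compared
with that of `c`. -/
def ColumnStep (n a b c i v v' : ℕ) : Prop :=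
  ∃ y, y ≤ n ∧ ∃ t, t ≤ n ∧ ∃ u, u ≤ n ∧ IsConv n a b i y ∧ t = v + y ∧ u = v' + v' ∧
    ((Bit c i ∧ t = u + 1) ∨ (¬ Bit c i ∧ t = u))

/-- `K` bounds all columns that can be nonzero; the carry starts and must end at 0. -/
def IsMul (n a b c : ℕ) : Prop :=
  ∃ K, K ≤ n ∧ ∃ o, o ≤ n ∧ o = 0 ∧
    (∀ i, i ≤ n → ∀ j, j ≤ n → Bit a i → Bit b j → ∃ p, p ≤ n ∧ p = i + j ∧ p < K) ∧
    (∀ i, i ≤ n → Bit c i → i < K) ∧ Iter n (ColumnStep n a b c) K o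

theorem dfn_isConv : bit.Dfn fun n (v : Fin 4 → ℕ) => IsConv n (v 0) (v 1) (v 2) (v 3) := by
  have hbit : bit.Dfn fun n (v : Fin 6 → ℕ) =>
      Bit (v 0) (v 3) ∧ ∃ l, l ≤ n ∧ v 2 = v 3 + l ∧ Bit (v 1) l :=
    .and (dfn_bit _ _) <| .ex <| .and (dfn_add _ _ _) (dfn_bit _ _)
  have step : bit.Dfn fun n (v : Fin 6 → ℕ) =>
      CountStep n (v 0) (v 1) (v 2) (v 3) (v 4) (v 5) :=
    .or (.and hbit (dfn_succ _ _)) (.and hbit.not (.eq _ _))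
  exact .ex <| .and (dfn_succ _ _) <|
    (dfn_iter step).subst ![some 0, some 1, some 2, none, some 3]

theorem dfn_isMul : bit.Dfn fun n (v : Fin 3 → ℕ) => IsMul n (v 0) (v 1) (v 2) := by
  have step : bit.Dfn fun n (v : Fin 6 → ℕ) =>
      ColumnStep n (v 0) (v 1) (v 2) (v 3) (v 4) (v 5) :=
    .ex <| .ex <| .ex <| .and (dfn_isConv.app₄ _ _ _ _) <| .and (dfn_add _ _ _) <|
      .and (dfn_add _ _ _) <| .or (.and (dfn_bit _ _) (dfn_succ _ _))
        (.and (dfn_bit _ _).not (.eq _ _))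
  refine .ex <| .ex <| .and (dfn_eq_const _ _) <| .and ?_ <| .and ?_ <|
    (dfn_iter step).subst ![some (some 0), some (some 1), some (some 2), some none, none]
  · exact .all <| .all <| .imp (dfn_bit _ _) <| .imp (dfn_bit _ _) <| .ex <|
      .and (dfn_add _ _ _) (dfn_lt _ _)
  · exact .all <| .imp (dfn_bit _ _) (dfn_lt _ _)

theorem countStep_iff {n a b k i v v' : ℕ} (hb : b ≤ n) :
    CountStep n a b k i v v' ↔ v + convCount a b k (i + 1) = v' + convCount a b k i := by
  classical
  have h : (∃ l, l ≤ n ∧ k = i + l ∧ Bit b l) ↔ ∃ l, k = i + l ∧ Bit b l :=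
    ⟨fun ⟨l, _, h⟩ => ⟨l, h⟩, fun ⟨l, h, h'⟩ => ⟨l, h'.lt.le.trans hb, h, h'⟩⟩
  rw [CountStep, h, convCount, convCount, Finset.sum_range_succ]
  split_ifs with hc
  · simp only [hc, not_true, false_and, or_false, true_and]
    omega
  · simp only [hc, not_false_eq_true, false_and, false_or, true_and]
    omega

theorem IsConv.eq {n a b k y : ℕ} (hb : b ≤ n) (h : IsConv n a b k y) : y = conv a b k := by
  obtain ⟨_, -, rfl, h⟩ := h
  refine h.invariant (P := fun i v => v = convCount a b k i) (by simp [convCount]) ?_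
  rintro i v v' hv rfl
  rw [countStep_iff hb] at hv
  omega

theorem isConv_conv {n a b k s t : ℕ} (hb : b ≤ n) (hs : 0 < s) (hn : 2 ^ (s * (t + 1)) ≤ n)
    (hk : k + 1 < 2 ^ s) (hkt : k + 1 ≤ t * t) : IsConv n a b k (conv a b k) := by
  have hsn : 2 ^ s ≤ n :=
    (Nat.pow_le_pow_right (by norm_num) (Nat.le_mul_of_pos_right s t.succ_pos)).trans hn
  refine ⟨k + 1, by omega, rfl, ?_⟩
  refine Iter.of_seq hs hn (convCount a b k) (by simp [convCount]) hk hkt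
    (fun i hi => ((convCount_le a b k i).trans hi).trans_lt hk) fun i _ => ?_
  rw [countStep_iff hb]
  omega

theorem IsMul.eq {n a b c : ℕ} (ha : a ≤ n) (hb : b ≤ n) (hc : c ≤ n) (h : IsMul n a b c) :
    c = a * b := by
  obtain ⟨K, -, _, -, rfl, hab, hcK, h⟩ := h
  have hK : ∀ i j, Bit a i → Bit b j → i + j < K := fun i j hi hj => by
    obtain ⟨_, -, rfl, h⟩ := hab i (hi.lt.le.trans ha) j (hj.lt.le.trans hb) hi hj
    exact h
  have hcK' : c < 2 ^ K := by
    refine Nat.lt_pow_two_of_testBit _ fun i hi => ?_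
    by_contra hbit
    rw [Bool.not_eq_false, ← bit_iff_testBit] at hbit
    exact absurd (hcK i (hbit.lt.le.trans hc) hbit) (by omega)
  -- The columns already added equal the digits of `c` checked so far plus the outstanding carry.
  have key := h.invariant
    (P := fun i v => ∑ k ∈ Finset.range i, conv a b k * 2 ^ k = c % 2 ^ i + 2 ^ i * v)
    (by simp [Nat.mod_one]) ?_
  · rw [sum_conv_mul_two_pow hK, Nat.mod_eq_of_lt hcK'] at key
    omega
  · rintro i v v' ⟨_, -, t, -, _, -, hy, ht, rfl, hd⟩ hv
    obtain rfl := hy.eq hb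
    rw [Finset.sum_range_succ, hv, Nat.mod_pow_succ]
    rw [bit_iff_mod] at hd
    have h2 : v + conv a b i = c / 2 ^ i % 2 + (v' + v') := by omega
    calc c % 2 ^ i + 2 ^ i * v + conv a b i * 2 ^ i
        = c % 2 ^ i + 2 ^ i * (v + conv a b i) := by ring
      _ = _ := by rw [h2]; ring

theorem isMul_mul {n a b s t L : ℕ} (hL : n < 2 ^ (L + 1)) (ha : a ≤ n) (hb : b ≤ n)
    (hc : a * b ≤ n) (hs : 0 < s) (hn : 2 ^ (s * (t + 1)) ≤ n) (hLs : 2 * (2 * L + 2) ≤ 2 ^ s)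
    (hLt : 2 * L + 2 ≤ t * t) : IsMul n a b (a * b) := by
  have hsn : 2 ^ s ≤ n :=
    (Nat.pow_le_pow_right (by norm_num) (Nat.le_mul_of_pos_right s t.succ_pos)).trans hn
  have hbit : ∀ x ≤ n, ∀ i, Bit x i → i ≤ L := fun x hx i hi => by
    have := (hi.two_pow_le.trans hx).trans_lt hL
    exact Nat.lt_succ_iff.1 ((Nat.pow_lt_pow_iff_right (by norm_num)).1 this)
  have hK : ∀ i j, Bit a i → Bit b j → i + j < 2 * L + 2 := fun i j hi hj => by
    have := hbit a ha i hi
    have := hbit b hb j hj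
    omega
  set K := 2 * L + 2 with hKdef
  let S : ℕ → ℕ := fun i => ∑ k ∈ Finset.range i, conv a b k * 2 ^ k
  have hSK : S K = a * b := sum_conv_mul_two_pow hK
  have hS1 : ∀ i, S (i + 1) = S i + conv a b i * 2 ^ i := fun i => Finset.sum_range_succ _ _
  have hdiv : ∀ i, S (i + 1) / 2 ^ i = S i / 2 ^ i + conv a b i := fun i => by
    rw [hS1, Nat.add_mul_div_right _ _ (Nat.two_pow_pos i)]
  have hSdiv : ∀ i, S (i + 1) / 2 ^ (i + 1) = (S i / 2 ^ i + conv a b i) / 2 := fun i => by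
    rw [pow_succ, ← Nat.div_div_eq_div_mul, hdiv]
  have hconv : ∀ i, conv a b i ≤ i + 1 := fun i => convCount_le _ _ _ _
  have hSle : ∀ i ≤ K, S i / 2 ^ i ≤ i := fun i => by
    induction i with
    | zero => simp [S]
    | succ i ih =>
      intro hi
      rw [hSdiv]
      have := ih (by omega)
      have := hconv i
      omega
  -- Later columns contribute multiples of `2 ^ i`, so bit `i` of the product depends only on `S (i
  -- + 1)`.
  have hmod : ∀ i ≤ K, ∃ r, a * b = S i + 2 ^ i * r := by
    have hadd : ∀ i d, ∃ r, S (i + d) = S i + 2 ^ i * r := fun i d => by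
      induction d with
      | zero => exact ⟨0, rfl⟩
      | succ d ih =>
        obtain ⟨r, hr⟩ := ih
        exact ⟨r + conv a b (i + d) * 2 ^ d, by rw [← add_assoc, hS1, hr]; ring⟩
    intro i hi
    obtain ⟨r, hr⟩ := hadd i (K - i)
    exact ⟨r, by rw [← hSK, ← hr, Nat.add_sub_cancel' hi]⟩
  have hcbit : ∀ i < K, (Bit (a * b) i ↔ (S i / 2 ^ i + conv a b i) % 2 = 1) := by
    intro i hi
    obtain ⟨r, hr⟩ := hmod (i + 1) hi
    rw [bit_iff_mod, ← hdiv, hr, pow_succ, mul_assoc, Nat.add_mul_div_left _ _ (Nat.two_pow_pos i)]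
    omega
  refine ⟨K, by omega, 0, Nat.zero_le n, rfl,
    fun i _ j _ hi hj => ⟨i + j, ?_, rfl, hK i j hi hj⟩, fun i _ hi => ?_, ?_⟩
  · have := hK i j hi hj
    omega
  · have := hbit _ hc i hi
    omega
  · have h0 : S K / 2 ^ K = 0 := by
      rw [hSK, Nat.div_eq_of_lt]
      exact hc.trans_lt (hL.trans_le (Nat.pow_le_pow_right (by norm_num) (by omega)))
    -- The carry into column `i` is `S i / 2 ^ i`, at most `i`; adding the column gives at most `2 *
    -- i + 1`, still below `2 ^ s`.
    have key := Iter.of_seq (G := ColumnStep n a b (a * b)) (j := K) hs hn (fun i => S i / 2 ^ i)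
      (by simp [S]) (by omega) hLt (fun i hi => (hSle i hi).trans_lt (by omega)) fun i hi => ?_
    · rwa [h0] at key
    · have h1 := hconv i
      have h2 := hSle i hi.le
      refine ⟨conv a b i, by omega, S i / 2 ^ i + conv a b i, by omega,
        S (i + 1) / 2 ^ (i + 1) + S (i + 1) / 2 ^ (i + 1), ?_,
        isConv_conv hb hs hn (by omega) (by omega), rfl, rfl, ?_⟩
      · rw [hSdiv]
        omega
      · rw [hcbit i hi]
        simp only [hSdiv]
        omega

theorem exists_block_size : ∃ N, ∀ n, N ≤ n → ∃ s t L, n < 2 ^ (L + 1) ∧ 0 < s ∧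
    2 ^ (s * (t + 1)) ≤ n ∧ 2 * (2 * L + 2) ≤ 2 ^ s ∧ 2 * L + 2 ≤ t * t := by
  have lin : ∀ r, 7 ≤ r → (2 * r + 4) * 5 ≤ 2 ^ r := fun r hr => by
    induction r, hr using Nat.le_induction with
    | base => norm_num
    | succ r hr ih =>
      rw [pow_succ]
      omega
  obtain ⟨M, hM⟩ : ∃ M, M = 4 ^ 7 := ⟨_, rfl⟩
  refine ⟨2 ^ M, fun n hn => ?_⟩
  have hn0 : n ≠ 0 := by
    have := Nat.two_pow_pos M
    omega
  set L := Nat.log 2 n with hL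
  have hML : M ≤ L := (Nat.le_log_iff_pow_le (by norm_num) hn0).2 hn
  have hL0 : L ≠ 0 := by omega
  set r := Nat.log 4 L with hr
  have hr7 : 7 ≤ r := (Nat.le_log_iff_pow_le (by norm_num) hL0).2 (hM ▸ hML)
  have h1 : 4 ^ r ≤ L := Nat.pow_log_le_self 4 hL0
  have h2 : L < 4 ^ (r + 1) := Nat.lt_pow_succ_log_self (by norm_num) L
  have h4 : (4 : ℕ) ^ r = 2 ^ r * 2 ^ r := by
    rw [← mul_pow]
    norm_num
  rw [pow_succ, h4] at h2
  rw [h4] at h1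
  -- With `4 ^ r ≤ L < 4 ^ (r + 1)`, both `2 ^ s` and `t * t` equal `16 * 4 ^ r`, while `s * (t +
  -- 1)` is at most `(2 * r + 4) * 5 * 2 ^ r ≤ 4 ^ r`.
  refine ⟨2 * r + 4, 4 * 2 ^ r, L, Nat.lt_pow_succ_log_self (by norm_num) n, by omega, ?_, ?_, ?_⟩
  · refine (Nat.pow_le_pow_right (by norm_num) (le_trans ?_ h1)).trans
      (Nat.pow_log_le_self 2 hn0)
    have := lin r hr7
    have h5 : 1 ≤ 2 ^ r := Nat.one_le_two_pow
    nlinarith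
  · rw [pow_add, two_mul r, pow_add]
    omega
  · nlinarith

/-- Multiplication is definable from `Bit`. -/
theorem dfn_mul {Γ : Type} (c a b : Γ) : bit.Dfn fun _ v => v c = v a * v b := by
  obtain ⟨N, hN⟩ := exists_block_size
  -- The finitely many small universes are handled by a multiplication table.
  have : bit.Dfn fun n (v : Γ → ℕ) => (¬ n < N ∧ IsMul n (v a) (v b) (v c)) ∨
      (n < N ∧ ∃ x, x < N ∧ v a = x ∧ ∃ y, y < N ∧ v b = y ∧ v c = x * y) :=
    .or (.and (dfn_size_lt N).not (dfn_isMul.app₃ _ _ _)) <| .and (dfn_size_lt N) <|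
      .ex_lt N fun x => .and (dfn_eq_const x a) <| .ex_lt N fun y =>
        .and (dfn_eq_const y b) (dfn_eq_const (x * y) c)
  refine this.congr fun n v hv => ?_
  have ha := hv a
  have hb := hv b
  have hc := hv c
  constructor
  · rintro (⟨-, h⟩ | ⟨-, x, -, rfl, y, -, rfl, h⟩)
    exacts [h.eq ha hb hc, h]
  · intro h
    by_cases hn : n < N
    · exact .inr ⟨hn, _, by omega, rfl, _, by omega, rfl, h⟩
    · obtain ⟨s, t, L, h1, h2, h3, h4, h5⟩ := hN n (not_lt.1 hn)
      rw [h] at hc ⊢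
      exact .inl ⟨hn, isMul_mul h1 ha hb hc h2 h3 h4 h5⟩

/-! ### The row major order -/

theorem q_succ (i : ℕ) : q (i + 1) = q i + i + 1 := by
  have h : (i + 1) * (i + 1 + 1) = i * (i + 1) + (i + 1) * 2 := by ring
  rw [q, q, h, Nat.add_mul_div_right _ _ two_pos, add_assoc]

theorem q_mono : Monotone q :=
  monotone_nat_of_le_succ fun i => by
    rw [q_succ]
    omega

theorem lt_q_succ_col (x : ℕ) : x < q (col x + 1) := by
  by_contra! h
  exact absurd ((isGreatest_col x).2 h) (by omega)

theorem row_le_col (x : ℕ) : row x ≤ col x := by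
  have h1 := q_col_add_row x
  have h2 := lt_q_succ_col x
  rw [q_succ] at h2
  omega

theorem col_q_add {c r : ℕ} (h : r ≤ c) : col (q c + r) = c := by
  refine (isGreatest_col _).unique ⟨Nat.le_add_right _ _, fun i hi => ?_⟩
  by_contra! hci
  have := (q_mono hci).trans hi
  rw [Nat.succ_eq_add_one, q_succ] at this
  omega

theorem row_q_add {c r : ℕ} (h : r ≤ c) : row (q c + r) = r := by
  rw [row, col_q_add h, Nat.add_sub_cancel_left]

theorem two_mul_q (i : ℕ) : 2 * q i = i * (i + 1) := by
  induction i with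
  | zero => rfl
  | succ i ih => rw [q_succ, mul_add, mul_add, ih]; ring

/-- Halving the even factor of `i * (i + 1)` writes `q i` as `a * (2 * a ± 1)`; thus no number above
`n`, such as `2 * z`, is needed. -/
theorem exists_eq_q_iff (n z : ℕ) (hz : z ≤ n) : (∃ i, z = q i) ↔ z = 0 ∨
    ∃ a, a ≤ n ∧ ∃ b, b ≤ n ∧ ∃ d, d ≤ n ∧ z = a * b ∧ b = a + d ∧ (d = a + 1 ∨ a = d + 1) := by
  constructor
  · rintro ⟨i, rfl⟩
    have h := two_mul_q i
    rcases Nat.even_or_odd' i with ⟨a, rfl | rfl⟩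
    · rcases Nat.eq_zero_or_pos a with rfl | ha
      · exact .inl rfl
      · have h1 : q (2 * a) = a * (2 * a + 1) := by
          apply Nat.eq_of_mul_eq_mul_left two_pos
          rw [h]
          ring
        have h2 : 2 * a + 1 ≤ a * (2 * a + 1) := Nat.le_mul_of_pos_left _ ha
        exact .inr ⟨a, by omega, 2 * a + 1, by omega, a + 1, by omega, h1, by omega, .inl rfl⟩
    · have h1 : q (2 * a + 1) = (a + 1) * (2 * a + 1) := by
        apply Nat.eq_of_mul_eq_mul_left two_pos
        rw [h]
        ring
      have h2 : 2 * a + 1 ≤ (a + 1) * (2 * a + 1) := Nat.le_mul_of_pos_left _ a.succ_pos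
      have h3 : a + 1 ≤ (a + 1) * (2 * a + 1) := Nat.le_mul_of_pos_right _ (Nat.succ_pos _)
      exact .inr ⟨a + 1, by omega, 2 * a + 1, by omega, a, by omega, h1, by omega, .inr rfl⟩
  · rintro (rfl | ⟨a, -, b, -, d, -, rfl, rfl, rfl | rfl⟩)
    · exact ⟨0, rfl⟩
    · refine ⟨2 * a, Nat.eq_of_mul_eq_mul_left two_pos ?_⟩
      rw [two_mul_q]
      ring
    · refine ⟨2 * d + 1, Nat.eq_of_mul_eq_mul_left two_pos ?_⟩
      rw [two_mul_q]
      ring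

theorem dfn_exists_eq_q {Γ : Type} (z : Γ) : bit.Dfn fun _ v => ∃ i, v z = q i := by
  have : bit.Dfn fun n (v : Γ → ℕ) => v z = 0 ∨ ∃ a, a ≤ n ∧ ∃ b, b ≤ n ∧ ∃ d, d ≤ n ∧
      v z = a * b ∧ b = a + d ∧ (d = a + 1 ∨ a = d + 1) :=
    .or (dfn_eq_const _ _) <| .ex <| .ex <| .ex <| .and (dfn_mul _ _ _) <|
      .and (dfn_add _ _ _) <| .or (dfn_succ _ _) (dfn_succ _ _)
  exact this.congr fun n v hv => (exists_eq_q_iff n _ (hv z)).symm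

theorem dfn_row {Γ : Type} (r x : Γ) : bit.Dfn fun _ v => v r = row (v x) := by
  have : bit.Dfn fun n (v : Γ → ℕ) => ∃ s, s ≤ n ∧ (∃ i, s = q i) ∧ v x = s + v r ∧
      ∀ s', s' ≤ n → (∃ i, s' = q i) → s < s' → v x < s' :=
    .ex <| .and (dfn_exists_eq_q _) <| .and (dfn_add _ _ _) <| .all <|
      .imp (dfn_exists_eq_q _) <| .imp (dfn_lt _ _) (dfn_lt _ _)
  refine this.congr fun n v hv => ?_
  have hx := hv x
  have hqx := q_col_add_row (v x)
  constructor
  · rintro ⟨_, -, ⟨i, rfl⟩, hi, h⟩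
    have h1 : i ≤ col (v x) := (isGreatest_col _).2 (show q i ≤ v x by omega)
    rcases (q_mono h1).lt_or_eq with h2 | h2
    · have := h _ (by omega) ⟨_, rfl⟩ h2
      omega
    · omega
  · intro h
    refine ⟨q (col (v x)), by omega, ⟨_, rfl⟩, by omega, ?_⟩
    rintro _ - ⟨i, rfl⟩ hi
    have h1 : col (v x) + 1 ≤ i := by
      by_contra! h'
      exact absurd (q_mono (Nat.lt_succ_iff.1 h')) (by omega)
    exact (lt_q_succ_col _).trans_le (q_mono h1)

/-- Within a row the numbers increase with the column, so columns need not be defined. -/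
theorem rowMajor_iff (x y : ℕ) : RowMajor x y ↔ row x < row y ∨ (row x = row y ∧ x < y) := by
  have hx := q_col_add_row x
  have hy := q_col_add_row y
  rw [RowMajor]
  refine or_congr Iff.rfl (and_congr_right fun h => ⟨fun hc => ?_, fun hl => ?_⟩)
  · have := q_mono (Nat.succ_le_of_lt hc)
    rw [Nat.succ_eq_add_one, q_succ] at this
    omega
  · by_contra! hc
    have := q_mono hc
    omega

theorem dfn_rowMajor {Γ : Type} (x y : Γ) : bit.Dfn fun _ v => RowMajor (v x) (v y) := by
  have : bit.Dfn fun n (v : Γ → ℕ) => ∃ r, r ≤ n ∧ ∃ r', r' ≤ n ∧ r = row (v x) ∧ r' = row (v y) ∧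
      (r < r' ∨ (r = r' ∧ v x < v y)) :=
    .ex <| .ex <| .and (dfn_row _ _) <| .and (dfn_row _ _) <|
      .or (dfn_lt _ _) <| .and (.eq _ _) (dfn_lt _ _)
  refine this.congr fun n v hv => ?_
  rw [rowMajor_iff]
  constructor
  · rintro ⟨_, -, _, -, rfl, rfl, h⟩
    exact h
  · exact fun h => ⟨_, (Nat.sub_le _ _).trans (hv x), _, (Nat.sub_le _ _).trans (hv y), rfl, rfl, h⟩

theorem atMostAsExpressive_ltRowMajor_bit : AtMostAsExpressive ltRowMajor bit := by
  refine .of_dfn fun k R => ?_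
  rcases R with _ | _
  · exact ⟨fun _ v => v 0 < v 1, dfn_lt 0 1, fun n v => Iff.rfl⟩
  · exact ⟨fun _ v => RowMajor (v 0) (v 1), dfn_rowMajor 0 1, fun n v => Iff.rfl⟩

/-- The words of even length are definable in `FO(Bit)`. -/
theorem definable_bit_even_length (A : Type) :
    Definable bit {l : List A | Even l.length} := by
  have : bit.Dfn fun n (_ : Empty → ℕ) => ∃ x, x ≤ n ∧ (∀ y, y ≤ n → ¬ x < y) ∧
      ∃ o, o ≤ n ∧ o = 0 ∧ Bit x o :=
    .ex <| .and (.all (dfn_lt _ _).not) <| .ex <| .and (dfn_eq_const _ _) (dfn_bit _ _)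
  obtain ⟨φ, hφ⟩ := this
  refine ⟨(LHom.sumInr : bit.lang →ᴸ (wordLang A).sum bit.lang).onFormula φ, fun n w => ?_⟩
  let := wordStr w
  let := bit.str n
  refine Iff.trans ?_ ((LHom.realize_onFormula _ φ).trans (hφ n _)).symm
  simp only [Set.mem_ofPred_eq, List.length_ofFn, bit_iff_mod]
  constructor
  · intro h
    refine ⟨n, le_rfl, fun y hy => by omega, 0, Nat.zero_le n, rfl, ?_⟩
    rw [pow_zero, Nat.div_one]
    rw [Nat.even_iff] at h
    omega
  · rintro ⟨x, hx, hmax, _, -, rfl, h⟩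
    have := hmax n le_rfl
    rw [pow_zero, Nat.div_one] at h
    rw [Nat.even_iff]
    omega

/-! ### Padding words to a triangular grid -/

/-- The word of length `q (m + 1)` with the letters of `w` in row `0` and `e` everywhere else. -/
def pad {A : Type} (e : A) {m : ℕ} (w : Fin (m + 1) → A) : Fin (q m + m + 1) → A := fun x =>
  if row x = 0 then w (Fin.ofNat (m + 1) (col x)) else e

theorem Neutral.append_replicate {A : Type} {e : A} {L : Set (List A)} (h : Neutral e L)
    (u t : List A) (k : ℕ) : u ++ List.replicate k e ++ t ∈ L ↔ u ++ t ∈ L := by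
  induction k generalizing u with
  | zero => simp
  | succ k ih =>
    rw [List.replicate_succ, ← List.singleton_append (l := List.replicate k e), ← List.append_assoc,
      ih, ← h]

/-- Column `M` contributes `f M` followed by `M` neutral letters. The suffix `t` lets the induction
work in front of this last column. -/
theorem Neutral.map_range_q {A : Type} {e : A} {L : Set (List A)} (h : Neutral e L) (f : ℕ → A)
    (M : ℕ) (t : List A) :
    (List.range (q M)).map (fun x => if row x = 0 then f (col x) else e) ++ t ∈ L ↔
      (List.range M).map f ++ t ∈ L := by
  induction M generalizing t with
  | zero => simp [q]
  | succ M ih =>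
    have hcol : ((List.range (M + 1)).map (q M + ·)).map
        (fun x => if row x = 0 then f (col x) else e) = f M :: List.replicate M e := by
      rw [List.range_succ_eq_map, List.map_map, List.map_cons, List.map_map]
      congr 1
      · have h1 := row_q_add (Nat.zero_le M)
        have h2 := col_q_add (Nat.zero_le M)
        simp only [Function.comp_apply, h1, h2, if_true]
      · refine List.eq_replicate_iff.2 ⟨by simp, fun b hb => ?_⟩
        obtain ⟨i, hi, rfl⟩ := List.mem_map.1 hb
        have h1 := row_q_add (Nat.succ_le_of_lt (List.mem_range.1 hi))
        simp only [Function.comp_apply, h1]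
        simp
    rw [q_succ, add_assoc, List.range_add, List.map_append, hcol, List.append_assoc, ih,
      List.range_succ, List.map_append, List.cons_append, List.map_singleton, List.append_assoc,
      List.singleton_append]
    have := h.append_replicate (List.map f (List.range M) ++ [f M]) t M
    simpa using this

theorem Neutral.ofFn_pad_mem {A : Type} {e : A} {L : Set (List A)} (h : Neutral e L) {m : ℕ}
    (w : Fin (m + 1) → A) : List.ofFn (pad e w) ∈ L ↔ List.ofFn w ∈ L := by
  have := h.map_range_q (fun c => w (Fin.ofNat (m + 1) c)) (m + 1) []
  rw [List.append_nil, List.append_nil, q_succ] at this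
  convert this using 2
  · refine List.ext_getElem (by simp) fun i h1 h2 => ?_
    simp only [List.getElem_ofFn, List.getElem_map, List.getElem_range, pad]
  · refine List.ext_getElem (by simp) fun i h1 h2 => ?_
    have hi : i < m + 1 := by simpa using h1
    simp only [List.getElem_ofFn, List.getElem_map, List.getElem_range]
    congr 1
    exact Fin.ext (Nat.mod_eq_of_lt hi).symm

/-- The element of the padded structure in row `r` and column `c`. -/
def gridPoint (m r c : ℕ) : Fin (q m + m + 1) := Fin.ofNat _ (q c + r)

theorem val_gridPoint {m r c : ℕ} (hr : r ≤ c) (hc : c ≤ m) : (gridPoint m r c : ℕ) = q c + r := by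
  have := q_mono hc
  exact Nat.mod_eq_of_lt (by omega)

theorem gridPoint_eq_iff {m r c r' c' : ℕ} (hr : r ≤ c) (hc : c ≤ m) (hr' : r' ≤ c')
    (hc' : c' ≤ m) : gridPoint m r c = gridPoint m r' c' ↔ r = r' ∧ c = c' := by
  refine ⟨fun h => ?_, fun ⟨h, h'⟩ => by rw [h, h']⟩
  have h1 := congrArg Fin.val h
  rw [val_gridPoint hr hc, val_gridPoint hr' hc'] at h1
  have h2 := row_q_add hr
  have h3 := col_q_add hr
  rw [h1, row_q_add hr'] at h2
  rw [h1, col_q_add hr'] at h3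
  exact ⟨h2.symm, h3.symm⟩

theorem gridPoint_lt_iff {m r c r' c' : ℕ} (hr : r ≤ c) (hc : c ≤ m) (hr' : r' ≤ c')
    (hc' : c' ≤ m) : (gridPoint m r c : ℕ) < gridPoint m r' c' ↔ c < c' ∨ (c = c' ∧ r < r') := by
  rw [val_gridPoint hr hc, val_gridPoint hr' hc']
  rcases lt_trichotomy c c' with h | rfl | h
  · have := q_mono (Nat.succ_le_of_lt h)
    rw [Nat.succ_eq_add_one, q_succ] at this
    omega
  · omega
  · have := q_mono (Nat.succ_le_of_lt h)
    rw [Nat.succ_eq_add_one, q_succ] at this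
    omega

theorem col_le_of_lt {m x : ℕ} (hx : x < q m + m + 1) : col x ≤ m := by
  by_contra! h
  have h1 := q_mono (Nat.succ_le_of_lt h)
  have h2 := q_col_add_row x
  rw [Nat.succ_eq_add_one, q_succ] at h1
  omega

theorem gridPoint_row_col {m : ℕ} (x : Fin (q m + m + 1)) :
    gridPoint m (row x) (col x) = x :=
  Fin.ext <| (val_gridPoint (row_le_col x) (col_le_of_lt x.2)).trans (q_col_add_row x)

/-! ### Interpreting the padded word in the original one. -/

section Interpretation

variable {A : Type}

/-- Uniform definability in `FO(<)` over all words over `A`. -/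
abbrev WordDfn {Γ : Type} (R : (Σ n : ℕ, Fin (n + 1) → A) → (Γ → ℕ) → Prop) : Prop :=
  UDef (L := (wordLang A).sum lt.lang) (fun i => i.1)
    (fun i => @sumStructure _ _ _ (wordStr i.2) (lt.str i.1)) R

theorem wordDfn_letter {Γ : Type} (a : A) (x : Γ) :
    WordDfn fun i v => i.2 (Fin.ofNat (i.1 + 1) (v x)) = a := by
  refine ⟨Relations.formula₁ (L := (wordLang A).sum lt.lang) (Sum.inl (LetterSym.letter a))
    (Term.var x), fun i v => ?_⟩
  have hx : Fin.ofNat (i.1 + 1) (v x : ℕ) = (v x : Fin (i.1 + 1)) :=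
    Fin.ext (Nat.mod_eq_of_lt (v x).2)
  exact iff_of_eq (congrArg (fun y => i.2 y = a) hx.symm)

theorem wordDfn_lt {Γ : Type} (x y : Γ) :
    WordDfn fun (_ : Σ n : ℕ, Fin (n + 1) → A) v => v x < v y := by
  refine ⟨Relations.formula₂ (L := (wordLang A).sum lt.lang)
    (show (wordLang A).Relations 2 ⊕ lt.lang.Relations 2 from Sum.inr OneBinary.rel)
    (Term.var x) (Term.var y), fun i v => Iff.rfl⟩

theorem wordDfn_eq_zero {Γ : Type} (x : Γ) :
    WordDfn fun (_ : Σ n : ℕ, Fin (n + 1) → A) v => v x = 0 := by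
  have : WordDfn fun (i : Σ n : ℕ, Fin (n + 1) → A) (v : Γ → ℕ) => ∀ y, y ≤ i.1 → ¬ y < v x :=
    .all (wordDfn_lt _ _).not
  refine this.congr fun i v _ => ⟨fun h => ?_, fun h y _ => by omega⟩
  have := h 0 (Nat.zero_le _)
  omega

theorem exists_eq_var {B : BuiltIns} {k : ℕ} (t : ((wordLang A).sum B.lang).Term (Empty ⊕ Fin k)) :
    ∃ j, t = Term.var (Sum.inr j) := by
  rcases t with (x | j) | ⟨f, _⟩
  · exact x.elim
  · exact ⟨j, rfl⟩
  · rcases f with f | f <;> exact Empty.elim f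

/-- Over words, `FO(<, ⊏)` on the padded word is interpreted in `FO(<)`, an element of the padded
word being represented by its row and its column. -/
theorem exists_wordDfn_pad (e : A) {k : ℕ}
    (φ : ((wordLang A).sum ltRowMajor.lang).BoundedFormula Empty k) :
    ∃ R : (Σ n : ℕ, Fin (n + 1) → A) → (ℕ × Bool → ℕ) → Prop, WordDfn R ∧ ∀ i v,
      (∀ j < k, v (j, true) ≤ v (j, false) ∧ v (j, false) ≤ i.1) →
      (R i v ↔ @BoundedFormula.Realize _ _
        (@sumStructure _ _ _ (wordStr (pad e i.2)) (ltRowMajor.str _)) _ _ φ default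
        fun j => gridPoint i.1 (v (j, true)) (v (j, false))) := by
  induction φ with
  | falsum => exact ⟨fun _ _ => False, .const False, fun i v _ => Iff.rfl⟩
  | equal t₁ t₂ =>
    obtain ⟨a, rfl⟩ := exists_eq_var t₁
    obtain ⟨b, rfl⟩ := exists_eq_var t₂
    refine ⟨fun _ v => v (a, true) = v (b, true) ∧ v (a, false) = v (b, false),
      .and (.eq _ _) (.eq _ _), fun i v hv => ?_⟩
    exact (gridPoint_eq_iff (hv a a.2).1 (hv a a.2).2 (hv b b.2).1 (hv b b.2).2).symm
  | rel R ts =>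
    choose js hjs using fun j => exists_eq_var (ts j)
    obtain rfl : ts = fun j => Term.var (Sum.inr (js j)) := funext hjs
    rcases R with R | R
    · rcases R with ⟨a⟩
      refine ⟨fun i v => (v (js 0, true) = 0 ∧ i.2 (Fin.ofNat (i.1 + 1) (v (js 0, false))) = a) ∨
        (¬ v (js 0, true) = 0 ∧ e = a), .or (.and (wordDfn_eq_zero _) (wordDfn_letter _ _))
          (.and (wordDfn_eq_zero _).not (.const _)), fun i v hv => ?_⟩
      obtain ⟨h1, h2⟩ := hv (js 0) (js 0).2
      have key : pad e i.2 (gridPoint i.1 (v (js 0, true)) (v (js 0, false))) = a ↔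
          (v (js 0, true) = 0 ∧ i.2 (Fin.ofNat (i.1 + 1) (v (js 0, false))) = a) ∨
            (¬ v (js 0, true) = 0 ∧ e = a) := by
        rw [pad, val_gridPoint h1 h2, row_q_add h1, col_q_add h1]
        split_ifs with h <;> simp [h]
      exact key.symm
    · rcases R with _ | _
      · refine ⟨fun _ v => v (js 0, false) < v (js 1, false) ∨
          (v (js 0, false) = v (js 1, false) ∧ v (js 0, true) < v (js 1, true)),
          .or (wordDfn_lt _ _) (.and (.eq _ _) (wordDfn_lt _ _)), fun i v hv => ?_⟩
        obtain ⟨h1, h2⟩ := hv (js 0) (js 0).2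
        obtain ⟨h3, h4⟩ := hv (js 1) (js 1).2
        exact (gridPoint_lt_iff h1 h2 h3 h4).symm
      · refine ⟨fun _ v => v (js 0, true) < v (js 1, true) ∨
          (v (js 0, true) = v (js 1, true) ∧ v (js 0, false) < v (js 1, false)),
          .or (wordDfn_lt _ _) (.and (.eq _ _) (wordDfn_lt _ _)), fun i v hv => ?_⟩
        obtain ⟨h1, h2⟩ := hv (js 0) (js 0).2
        obtain ⟨h3, h4⟩ := hv (js 1) (js 1).2
        have key : RowMajor (gridPoint i.1 (v (js 0, true)) (v (js 0, false)))
            (gridPoint i.1 (v (js 1, true)) (v (js 1, false))) ↔ v (js 0, true) < v (js 1, true) ∨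
            (v (js 0, true) = v (js 1, true) ∧ v (js 0, false) < v (js 1, false)) := by
          rw [RowMajor, val_gridPoint h1 h2, val_gridPoint h3 h4, row_q_add h1, row_q_add h3,
            col_q_add h1, col_q_add h3]
        exact key.symm
  | imp f g ihf ihg =>
    obtain ⟨R, hR, h⟩ := ihf
    obtain ⟨R', hR', h'⟩ := ihg
    exact ⟨fun i v => R i v → R' i v, hR.imp hR', fun i v hv => imp_congr (h i v hv) (h' i v hv)⟩
  | @all k f ih =>
    obtain ⟨R, hR, h⟩ := ih
    -- The flag `true` marks rows and `false` columns; the new element is stored in slot `k`.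
    let ext : (ℕ × Bool → ℕ) → ℕ → ℕ → ℕ × Bool → ℕ := fun v c r p =>
      if p.1 = k then (if p.2 then r else c) else v p
    refine ⟨fun i v => ∀ c, c ≤ i.1 → ∀ r, r ≤ i.1 → ¬ c < r → R i (ext v c r), ?_, ?_⟩
    · refine .all <| .all <| .imp (wordDfn_lt _ _).not ?_
      refine (hR.subst fun p : ℕ × Bool => if p.1 = k then (if p.2 then none else some none)
        else some (some p)).congr fun i v _ => iff_of_eq (congrArg _ (funext fun p => ?_))
      simp only [ext]
      split_ifs <;> rfl
    · intro i v hv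
      have key : ∀ r c, r ≤ c → c ≤ i.1 → (R i (ext v c r) ↔ @BoundedFormula.Realize _ _
          (@sumStructure _ _ _ (wordStr (pad e i.2)) (ltRowMajor.str _)) _ _ f default
          (Fin.snoc (fun j : Fin k => gridPoint i.1 (v (j, true)) (v (j, false)))
            (gridPoint i.1 r c))) := by
        intro r c hr hc
        rw [h i (ext v c r) ?_]
        · refine iff_of_eq (congrArg _ (funext fun j => ?_))
          refine Fin.lastCases ?_ (fun j => ?_) j
          · simp [ext]
          · simp [ext, j.2.ne]
        · intro j hj
          rcases Nat.lt_succ_iff_lt_or_eq.1 hj with hj | rfl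
          · simpa [ext, hj.ne] using hv j hj
          · simpa [ext] using ⟨hr, hc⟩
      constructor
      · intro H x
        have hx := col_le_of_lt x.2
        have := (key _ _ (row_le_col x) hx).1
          (H _ hx _ ((row_le_col x).trans hx) (row_le_col x).not_gt)
        rwa [gridPoint_row_col] at this
      · intro H c hc r _ hrc
        exact (key r c (not_lt.1 hrc) hc).2 (H _)

theorem realize_sentence_iff {L : FirstOrder.Language.{0, 0}} {M : Type} {_ : L.Structure M}
    (φ : L.Sentence) (v : Empty → M) (xs : Fin 0 → M) :
    BoundedFormula.Realize φ v xs ↔ φ.Realize M := by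
  rw [Sentence.Realize, Formula.Realize, Subsingleton.elim v default, Subsingleton.elim xs default]

theorem exists_sentence_pad (e : A) (φ : ltRowMajor.Sentence (wordLang A)) :
    ∃ ψ : lt.Sentence (wordLang A), ∀ (n : ℕ) (w : Fin (n + 1) → A),
      lt.Models (wordStr w) ψ ↔ ltRowMajor.Models (wordStr (pad e w)) φ := by
  obtain ⟨R, hR, h⟩ := exists_wordDfn_pad e φ
  -- `R` still has free slots, none of which matters for a sentence; all are filled with one dummy
  -- element.
  have : WordDfn fun (i : Σ n : ℕ, Fin (n + 1) → A) (_ : Empty → ℕ) =>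
      ∃ x, x ≤ i.1 ∧ R i fun _ => x := .ex <| hR.subst fun _ => none
  obtain ⟨ψ, hψ⟩ := this
  refine ⟨ψ, fun n w => (hψ ⟨n, w⟩ _).trans ?_⟩
  have key : ∀ x, R ⟨n, w⟩ (fun _ => x) ↔ ltRowMajor.Models (wordStr (pad e w)) φ := fun x =>
    (h ⟨n, w⟩ (fun _ => x) fun j hj => absurd hj (Nat.not_lt_zero j)).trans
      (realize_sentence_iff _ _ _)
  exact ⟨fun ⟨x, _, hx⟩ => (key x).1 hx, fun hx => ⟨0, Nat.zero_le _, (key 0).2 hx⟩⟩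

theorem craneBeachProperty_ltRowMajor : CraneBeachProperty ltRowMajor := by
  rintro A _ L ⟨φ, hφ⟩ ⟨e, he⟩
  obtain ⟨ψ, hψ⟩ := exists_sentence_pad e φ
  exact ⟨ψ, fun n w => by rw [hψ, ← hφ, he.ofFn_pad_mem]⟩

end Interpretation

/-! ### Finite linear orders -/

/-- Differences agree up to the threshold `d`. -/
def Similar {J : Type} (d : ℤ) (a b : J → ℤ) : Prop :=
  ∀ i j t, -d ≤ t → t ≤ d → (a i - a j ≤ t ↔ b i - b j ≤ t)

theorem Similar.mono {J : Type} {d d' : ℤ} {a b : J → ℤ} (h : Similar d a b) (hd : d' ≤ d) :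
    Similar d' a b := fun i j t h1 h2 => h i j t (by omega) (by omega)

theorem Similar.symm {J : Type} {d : ℤ} {a b : J → ℤ} (h : Similar d a b) : Similar d b a :=
  fun i j t h1 h2 => (h i j t h1 h2).symm

/-- A point within `d` of some `a i` is copied with its offset. Otherwise it goes `d + 1` above the
image of its nearest lower neighbour; the gap around it exceeds `2 * d + 1`, hence so does the gap
in `b`. -/
theorem Similar.exists_extend {J : Type} [Finite J] {d : ℤ} (hd : 0 ≤ d) {a b : J → ℤ}
    (h : Similar (2 * d + 1) a b) (x : ℤ) {l : J} (hl : a l ≤ x) :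
    ∃ y, ∀ i t, -d ≤ t → t ≤ d → (x - a i ≤ t ↔ y - b i ≤ t) ∧ (a i - x ≤ t ↔ b i - y ≤ t) := by
  by_cases hx : ∃ i, -d ≤ x - a i ∧ x - a i ≤ d
  · obtain ⟨i, h1, h2⟩ := hx
    refine ⟨b i + (x - a i), fun j t h3 h4 => ?_⟩
    have h5 := h i j (t - (x - a i)) (by omega) (by omega)
    have h6 := h j i (t + (x - a i)) (by omega) (by omega)
    omega
  · push Not at hx
    obtain ⟨i, hi, hmax⟩ := Set.exists_max_image {i | a i ≤ x} a (Set.toFinite _) ⟨l, hl⟩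
    refine ⟨b i + d + 1, fun j t h3 h4 => ?_⟩
    have hi' : a i ≤ x := hi
    have h5 := hx i (by omega)
    have h6 := h i j 0 (by omega) (by omega)
    have h7 := h j i 0 (by omega) (by omega)
    have h8 := h j i (2 * d + 1) (by omega) (by omega)
    have h9 := hx j
    rcases le_or_gt (a j) x with hj | hj
    · have := hmax j hj
      omega
    · omega

/-- A tuple in `[m]` together with the end points of `[m]`. -/
def withEnds {k m : ℕ} (xs : Fin k → Fin (m + 1)) : Fin k ⊕ Bool → ℤ :=
  Sum.elim (fun j => (xs j : ℕ)) fun b => if b then m else 0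

theorem exists_similar_snoc {k m m' : ℕ} {d : ℤ} (hd : 0 ≤ d) {xs : Fin k → Fin (m + 1)}
    {ys : Fin k → Fin (m' + 1)} (h : Similar (2 * d + 1) (withEnds xs) (withEnds ys))
    (x : Fin (m + 1)) : ∃ y : Fin (m' + 1), Similar d
      (withEnds (Fin.snoc xs x : Fin (k + 1) → Fin (m + 1)))
      (withEnds (Fin.snoc ys y : Fin (k + 1) → Fin (m' + 1))) := by
  -- The end points among the coordinates keep `y` inside `[m']`.
  obtain ⟨y, hy⟩ := h.exists_extend hd (x : ℕ) (l := Sum.inr false) (by simp [withEnds])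
  have h0 := (hy (Sum.inr false) 0 (by omega) hd).2
  have h1 := (hy (Sum.inr true) 0 (by omega) hd).1
  have hx := x.2
  simp only [withEnds, Sum.elim_inr, Bool.false_eq_true, if_false, if_true] at h0 h1
  lift y to ℕ using by omega
  refine ⟨⟨y, by omega⟩, ?_⟩
  let g : Fin (k + 1) ⊕ Bool → Option (Fin k ⊕ Bool) :=
    Sum.elim (Fin.lastCases none fun j => some (Sum.inl j)) fun b => some (Sum.inr b)
  have hg : ∀ {m : ℕ} (xs : Fin k → Fin (m + 1)) (x : Fin (m + 1)) i,
      withEnds (Fin.snoc xs x : Fin (k + 1) → Fin (m + 1)) i =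
        (g i).elim ((x : ℕ) : ℤ) (withEnds xs) := by
    rintro m xs x (i | i)
    · refine Fin.lastCases ?_ (fun i => ?_) i <;> simp [g, withEnds]
    · rfl
  intro i j t h2 h3
  rw [hg, hg, hg, hg]
  rcases g i with _ | i <;> rcases g j with _ | j
  · simp
  · exact (hy j t h2 h3).1
  · exact (hy i t h2 h3).2
  · exact h i j t (by omega) (by omega)

/-- Sentences of `FO(<)` cannot distinguish long words over a one-letter alphabet. -/
theorem exists_realize_iff_of_similar {k : ℕ}
    (φ : ((wordLang Unit).sum lt.lang).BoundedFormula Empty k) :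
    ∃ d : ℤ, 0 ≤ d ∧ ∀ (m m' : ℕ) (w : Fin (m + 1) → Unit) (w' : Fin (m' + 1) → Unit)
      (xs : Fin k → Fin (m + 1)) (ys : Fin k → Fin (m' + 1)),
      Similar d (withEnds xs) (withEnds ys) →
      (@BoundedFormula.Realize _ _ (@sumStructure _ _ _ (wordStr w) (lt.str m)) _ _ φ default xs ↔
        @BoundedFormula.Realize _ _ (@sumStructure _ _ _ (wordStr w') (lt.str m')) _ _ φ
          default ys) := by
  induction φ with
  | falsum => exact ⟨0, le_rfl, fun _ _ _ _ _ _ _ => Iff.rfl⟩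
  | equal t₁ t₂ =>
    obtain ⟨a, rfl⟩ := exists_eq_var t₁
    obtain ⟨b, rfl⟩ := exists_eq_var t₂
    refine ⟨0, le_rfl, fun m m' w w' xs ys h => ?_⟩
    have h1 := h (Sum.inl a) (Sum.inl b) 0 (by simp) le_rfl
    have h2 := h (Sum.inl b) (Sum.inl a) 0 (by simp) le_rfl
    simp only [withEnds, Sum.elim_inl] at h1 h2
    have key : xs a = xs b ↔ ys a = ys b := by
      rw [Fin.ext_iff, Fin.ext_iff]
      omega
    exact key
  | rel R ts =>
    choose js hjs using fun j => exists_eq_var (ts j)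
    obtain rfl : ts = fun j => Term.var (Sum.inr (js j)) := funext hjs
    rcases R with R | R
    · rcases R with ⟨a⟩
      exact ⟨0, le_rfl, fun m m' w w' xs ys h =>
        iff_of_true (Subsingleton.elim (α := Unit) _ _) (Subsingleton.elim (α := Unit) _ _)⟩
    · rcases R with _ | _
      refine ⟨0, le_rfl, fun m m' w w' xs ys h => ?_⟩
      have h1 := h (Sum.inl (js 1)) (Sum.inl (js 0)) 0 (by simp) le_rfl
      simp only [withEnds, Sum.elim_inl] at h1
      have key : (xs (js 0) : ℕ) < xs (js 1) ↔ (ys (js 0) : ℕ) < ys (js 1) := by omega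
      exact key
  | imp f g ihf ihg =>
    obtain ⟨d, hd, h⟩ := ihf
    obtain ⟨d', hd', h'⟩ := ihg
    exact ⟨max d d', hd.trans (le_max_left _ _), fun m m' w w' xs ys hs => imp_congr
      (h m m' w w' xs ys (hs.mono (le_max_left _ _)))
      (h' m m' w w' xs ys (hs.mono (le_max_right _ _)))⟩
  | all f ih =>
    obtain ⟨d, hd, h⟩ := ih
    refine ⟨2 * d + 1, by omega, fun m m' w w' xs ys hs => ⟨fun H y => ?_, fun H x => ?_⟩⟩
    · obtain ⟨x, hx⟩ := exists_similar_snoc hd hs.symm y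
      exact (h m m' w w' _ _ hx.symm).1 (H x)
    · obtain ⟨y, hy⟩ := exists_similar_snoc hd hs x
      exact (h m m' w w' _ _ hy).2 (H y)

theorem not_definable_ltRowMajor_even_length :
    ¬ Definable ltRowMajor {l : List Unit | Even l.length} := by
  rintro ⟨φ, hφ⟩
  obtain ⟨ψ, hψ⟩ := exists_sentence_pad () φ
  obtain ⟨d, hd, h⟩ := exists_realize_iff_of_similar ψ
  lift d to ℕ using hd
  have key : ∀ m, Even (q (m + 1)) ↔ lt.Models (wordStr fun _ : Fin (m + 1) => ()) ψ := by
    intro m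
    rw [hψ, ← hφ, q_succ]
    simp
  have hs : Similar (d : ℤ) (withEnds (default : Fin 0 → Fin (4 * d + 3 + 1)))
      (withEnds (default : Fin 0 → Fin (4 * d + 4 + 1))) := by
    rintro (i | i) (j | j) t h1 h2
    · exact i.elim0
    · exact i.elim0
    · exact j.elim0
    · rcases i with _ | _ <;> rcases j with _ | _ <;> simp [withEnds] <;> omega
  -- Both orders look alike up to threshold `d`, but `q (4 * d + 4)` is even and `q (4 * d + 5)`
  -- exceeds it by the odd number `4 * d + 5`.
  have hiff : Even (q (4 * d + 3 + 1)) ↔ Even (q (4 * d + 4 + 1)) := by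
    rw [key, key]
    exact (realize_sentence_iff _ _ _).symm.trans <| (h _ _ _ _ _ _ hs).trans <|
      realize_sentence_iff _ _ _
  have h1 : q (4 * d + 3 + 1) = 2 * ((d + 1) * (4 * d + 5)) :=
    Nat.eq_of_mul_eq_mul_left two_pos (by rw [two_mul_q]; ring)
  rw [q_succ (4 * d + 4), show 4 * d + 4 = 4 * d + 3 + 1 from rfl, h1, Nat.even_iff,
    Nat.even_iff] at hiff
  omega

end CraneBeach

theorem theorem4p1 :
    CraneBeach.StrictlyLessExpressive CraneBeach.ltRowMajor CraneBeach.bit ∧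
    (∃ (A : Type) (_ : Finite A) (L : Set (List A)),
      CraneBeach.Definable CraneBeach.bit L ∧ ¬ CraneBeach.Definable CraneBeach.ltRowMajor L) ∧
    CraneBeach.CraneBeachProperty CraneBeach.ltRowMajor := by
  have hbit := CraneBeach.definable_bit_even_length Unit
  have hlt := CraneBeach.not_definable_ltRowMajor_even_length
  refine ⟨⟨CraneBeach.atMostAsExpressive_ltRowMajor_bit, fun H => hlt ?_⟩,
    ⟨Unit, inferInstance, _, hbit, hlt⟩, CraneBeach.craneBeachProperty_ltRowMajor⟩
  obtain ⟨φ, hφ⟩ := hbit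
  obtain ⟨ψ, hψ⟩ := H _ φ
  exact ⟨ψ, fun n w => (hφ n w).trans (hψ n _)⟩
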